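/- Let $k$ be an algebraically closed field of characteristic $0$, let $K$ be a Hopf algebra over $k$, and let $R$ be a braided Hopf algebra in the category ${}_K^K\mathcal{YD}$ of left Yetter–Drinfeld modules over $K$, with action of $K$ written $h.r$ and coaction $\delta : R \to K\otimes R$. Assume hypothesis (A): there are a basis $x_1,\dots,x_\theta$ of the space $P(R)$ of primitive elements of $R$, group-like elements $g_1,\dots,g_\theta\in G(K)$ and algebra maps $\chi_1,\dots,\chi_\theta : K\to k$ such that, for all $j$, $\delta(x_j)=g_j\otimes x_j$, $h.x_j=\chi_j(h)x_j$ for all $h\in K$, and $q_j:=\chi_j(g_j)$ has finite multiplicative order $N_j$. If $\dim_k R=N_1\cdots N_\theta$, then: (i) $\chi_j(g_i)\chi_i(g_j)=1$ for all $i\neq j$; (ii) $R$ is the quantum linear space $\mathcal R(g_1,\dots,g_\theta;\chi_1,\dots,\chi_\theta)$. That is, $N_j>1$ for all $j$; $g_ig_j=g_jg_i$ and $\chi_i\chi_j=\chi_j\chi_i$ (convolution product) for all $i,j$; $\chi_i(h)g_i=h_{(1)}\chi_i(h_{(2)})g_i\mathcal S(h_{(3)})$ for all $i$ and all $h\in K$;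 and $R$ is isomorphic, as a braided Hopf algebra in ${}_K^K\mathcal{YD}$, to the algebra generated by $X_1,\dots,X_\theta$ with relations $X_i^{N_i}=0$ for all $i$ and $X_iX_j=\chi_j(g_i)X_jX_i$ for $i\neq j$, equipped with the braided Hopf algebra structure in which each $X_j$ is primitive, $\delta(X_j)=g_j\otimes X_j$ and $h.X_j=\chi_j(h)X_j$ for all $h\in K$. -/

import Mathlib

open scoped TensorProduct

noncomputable section

namespace YetterDrinfeld

section Modules

variable {k : Type*} [Field k] {K : Type*} [Ring K] [HopfAlgebra k K]

/-- The linear map `K ⊗ K ⊗ K → End (K ⊗ M)` sending `a ⊗ b ⊗ c` to the endomorphism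
`h ⊗ m ↦ a h S(c) ⊗ b.m`, where `K` acts on `M` through `act`. -/
def twistedAct {M : Type*} [AddCommGroup M] [Module k M] (act : K →ₐ[k] Module.End k M) :
    K ⊗[k] (K ⊗[k] K) →ₗ[k] Module.End k (K ⊗[k] M) :=
  TensorProduct.lift (LinearMap.mk₂ k
    (fun (a : K) (t : K ⊗[k] K) =>
      LinearMap.rTensor M (LinearMap.mulLeft k a) ∘ₗ
        TensorProduct.homTensorHomMap (RingHom.id k) K M K M
          (TensorProduct.map ((LinearMap.mul k K).flip ∘ₗ HopfAlgebra.antipode k)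
            act.toLinearMap (TensorProduct.comm k K K t)))
    (fun a a' t => by
      rw [← LinearMap.add_comp, ← LinearMap.rTensor_add]
      congr 2
      ext b
      simp [add_mul])
    (fun c a t => by
      rw [← LinearMap.smul_comp, ← LinearMap.rTensor_smul]
      congr 2
      ext b
      simp)
    (fun a t t' => by simp [LinearMap.comp_add])
    (fun c a t => by simp [LinearMap.comp_smul]))

theorem twistedAct_tmul {M : Type*} [AddCommGroup M] [Module k M]
    (act : K →ₐ[k] Module.End k M) (a b c h : K) (m : M) :
    twistedAct act (a ⊗ₜ (b ⊗ₜ c)) (h ⊗ₜ m) =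
      (a * (h * HopfAlgebra.antipode k c)) ⊗ₜ[k] act b m := by
  simp [twistedAct]

/-- The iterated comultiplication `h ↦ h₍₁₎ ⊗ h₍₂₎ ⊗ h₍₃₎` of `K`. -/
def comul₃ : K →ₗ[k] K ⊗[k] (K ⊗[k] K) :=
  LinearMap.lTensor K Coalgebra.comul ∘ₗ Coalgebra.comul

variable (k K) in
/-- The structure of a (left-left) Yetter-Drinfeld module over the Hopf algebra `K` on the
`k`-vector space `M`: an action of `K`, a coassociative and counital coaction `M → K ⊗ M`, and the
compatibility `δ(h.m) = h₍₁₎ m₍₋₁₎ S(h₍₃₎) ⊗ h₍₂₎.m₍₀₎`. -/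
structure YDModule (M : Type*) [AddCommGroup M] [Module k M] where
  /-- The action of `K`. -/
  act : K →ₐ[k] Module.End k M
  /-- The coaction of `K`. -/
  coact : M →ₗ[k] K ⊗[k] M
  coact_coassoc : TensorProduct.assoc k K K M ∘ₗ Coalgebra.comul.rTensor M ∘ₗ coact =
    coact.lTensor K ∘ₗ coact
  coact_counit : Coalgebra.counit.rTensor M ∘ₗ coact = TensorProduct.mk k k M 1
  coact_act : ∀ h m, coact (act h m) = twistedAct act (comul₃ h) (coact m)

namespace YDModule

variable {M : Type*} [AddCommGroup M] [Module k M] (V : YDModule k K M)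

/-- The diagonal action `h.(m ⊗ n) = h₍₁₎.m ⊗ h₍₂₎.n` of `K` on `M ⊗ M`. -/
def diagAct : K →ₗ[k] Module.End k (M ⊗[k] M) :=
  TensorProduct.homTensorHomMap (RingHom.id k) M M M M ∘ₗ
    TensorProduct.map V.act.toLinearMap V.act.toLinearMap ∘ₗ Coalgebra.comul

/-- The codiagonal coaction `m ⊗ n ↦ m₍₋₁₎ n₍₋₁₎ ⊗ (m₍₀₎ ⊗ n₍₀₎)` of `K` on `M ⊗ M`. -/
def codiagCoact : M ⊗[k] M →ₗ[k] K ⊗[k] (M ⊗[k] M) :=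
  LinearMap.rTensor (M ⊗[k] M) (LinearMap.mul' k K) ∘ₗ
    (TensorProduct.tensorTensorTensorComm k K M K M).toLinearMap ∘ₗ
      TensorProduct.map V.coact V.coact

/-- The braiding `c(m ⊗ n) = m₍₋₁₎.n ⊗ m₍₀₎` of `M` with itself. -/
def braiding : M ⊗[k] M →ₗ[k] M ⊗[k] M :=
  LinearMap.rTensor M (TensorProduct.lift V.act.toLinearMap) ∘ₗ
    (TensorProduct.assoc k K M M).symm.toLinearMap ∘ₗ
      LinearMap.lTensor K (TensorProduct.comm k M M).toLinearMap ∘ₗ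
        (TensorProduct.assoc k K M M).toLinearMap ∘ₗ LinearMap.rTensor M V.coact

end YDModule

end Modules

section BraidedHopfAlgebras

variable {k : Type*} [Field k] {K : Type*} [Ring K] [HopfAlgebra k K]
  {R : Type*} [Ring R] [Algebra k R]

/-- The multiplication `(m ⊗ m) (id ⊗ c ⊗ id)` of `R ⊗ R` given by the multiplication `m` of `R`
and the braiding `c`. -/
def braidedMul (V : YDModule k K R) : (R ⊗[k] R) ⊗[k] (R ⊗[k] R) →ₗ[k] R ⊗[k] R :=
  TensorProduct.map (LinearMap.mul' k R) (LinearMap.mul' k R) ∘ₗ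
    (TensorProduct.assoc k R R (R ⊗[k] R)).symm.toLinearMap ∘ₗ
      LinearMap.lTensor R ((TensorProduct.assoc k R R R).toLinearMap ∘ₗ
        LinearMap.rTensor R V.braiding ∘ₗ (TensorProduct.assoc k R R R).symm.toLinearMap) ∘ₗ
          (TensorProduct.assoc k R R (R ⊗[k] R)).toLinearMap

variable (k K R) in
/-- The structure of a braided Hopf algebra in the category of Yetter-Drinfeld modules over `K` on
the `k`-algebra `R`: a Yetter-Drinfeld module structure and a coalgebra structure on `R` such that
the multiplication, the unit, the comultiplication and the counit are morphisms of Yetter-Drinfeld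
modules, such that the comultiplication and the counit are algebra maps (where `R ⊗ R` carries the
braided multiplication), and such that the identity has a convolution inverse, the antipode (which
is then automatically unique and a morphism of Yetter-Drinfeld modules). -/
structure BraidedHopfAlgebra extends YDModule k K R, Coalgebra k R where
  act_mul : ∀ h, act h ∘ₗ LinearMap.mul' k R = LinearMap.mul' k R ∘ₗ toYDModule.diagAct h
  act_one : ∀ h, act h 1 = Coalgebra.counit (R := k) h • (1 : R)
  coact_mul : coact ∘ₗ LinearMap.mul' k R =
    LinearMap.lTensor K (LinearMap.mul' k R) ∘ₗ toYDModule.codiagCoact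
  coact_one : coact 1 = 1 ⊗ₜ 1
  comul_act : ∀ h, comul ∘ₗ act h = toYDModule.diagAct h ∘ₗ comul
  counit_act : ∀ h r, counit (act h r) = Coalgebra.counit (R := k) h * counit r
  coact_comul : toYDModule.codiagCoact ∘ₗ comul = LinearMap.lTensor K comul ∘ₗ coact
  coact_counit' : ∀ r, LinearMap.lTensor K counit (coact r) = 1 ⊗ₜ counit r
  comul_mul : ∀ a b, comul (a * b) = braidedMul toYDModule (comul a ⊗ₜ comul b)
  comul_one : comul 1 = 1 ⊗ₜ 1
  counit_mul : ∀ a b, counit (a * b) = counit a * counit b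
  counit_one : counit 1 = 1
  /-- The antipode. -/
  antipode : R →ₗ[k] R
  mul_antipode_rTensor_comul :
    LinearMap.mul' k R ∘ₗ antipode.rTensor R ∘ₗ comul = Algebra.linearMap k R ∘ₗ counit
  mul_antipode_lTensor_comul :
    LinearMap.mul' k R ∘ₗ antipode.lTensor R ∘ₗ comul = Algebra.linearMap k R ∘ₗ counit

namespace BraidedHopfAlgebra

/-- The space `P(R)` of primitive elements, `Δ(r) = r ⊗ 1 + 1 ⊗ r`. -/
def primitives (B : BraidedHopfAlgebra k K R) : Submodule k R :=
  LinearMap.eqLocus B.comul ((TensorProduct.mk k R R).flip 1 + TensorProduct.mk k R R 1)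

theorem mem_primitives (B : BraidedHopfAlgebra k K R) (r : R) :
    r ∈ B.primitives ↔ B.comul r = r ⊗ₜ 1 + 1 ⊗ₜ r := by
  simp [primitives]

/-- `e` is an isomorphism of braided Hopf algebras: an isomorphism of algebras that is a morphism
of Yetter-Drinfeld modules and of coalgebras. -/
structure IsIso {R' : Type*} [Ring R'] [Algebra k R'] (B : BraidedHopfAlgebra k K R)
    (B' : BraidedHopfAlgebra k K R') (e : R ≃ₐ[k] R') : Prop where
  map_act : ∀ h r, e (B.act h r) = B'.act h (e r)
  map_coact : ∀ r, B'.coact (e r) = LinearMap.lTensor K e.toLinearMap (B.coact r)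
  map_comul : ∀ r, B'.comul (e r) = TensorProduct.map e.toLinearMap e.toLinearMap (B.comul r)
  map_counit : ∀ r, B'.counit (e r) = B.counit r

/-- `g i` is group-like, and the `x i` are homogeneous with group-likes `g i` and characters
`χ i`: `δ(x i) = g i ⊗ x i` and `h.(x i) = χ i (h) x i` for all `h` in `K`. -/
structure IsHomogeneousFamily (B : BraidedHopfAlgebra k K R) {ι : Type*} (x : ι → R) (g : ι → K)
    (χ : ι → K →ₐ[k] k) : Prop where
  isGroupLike : ∀ i, IsGroupLikeElem k (g i)
  coact_eq : ∀ i, B.coact (x i) = g i ⊗ₜ x i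
  act_eq : ∀ i h, B.act h (x i) = χ i h • x i

/-- Hypothesis (A) for the basis `x` of the space of primitive elements, the group-likes `g` and
the characters `χ`. -/
structure HypothesisA (B : BraidedHopfAlgebra k K R) {θ : ℕ}
    (x : Module.Basis (Fin θ) k B.primitives) (g : Fin θ → K) (χ : Fin θ → K →ₐ[k] k) : Prop where
  homogeneous : B.IsHomogeneousFamily (fun i => (x i : R)) g χ
  isOfFinOrder : ∀ i, IsOfFinOrder (χ i (g i))

end BraidedHopfAlgebra

end BraidedHopfAlgebras

section QuantumLinearSpaces

variable {k : Type*} [Field k] {K : Type*} [Ring K] [HopfAlgebra k K] {θ : ℕ}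

/-- The convolution product `h ↦ χ(h₍₁₎) ψ(h₍₂₎)` of two characters. -/
def convMul (χ ψ : K →ₐ[k] k) : K →ₗ[k] k :=
  LinearMap.mul' k k ∘ₗ TensorProduct.map χ.toLinearMap ψ.toLinearMap ∘ₗ Coalgebra.comul

/-- The map `h ↦ h₍₁₎ χ(h₍₂₎) g S(h₍₃₎)`. -/
def twistedConj (g : K) (χ : K →ₐ[k] k) : K →ₗ[k] K :=
  LinearMap.mul' k K ∘ₗ
    LinearMap.lTensor K
      (TensorProduct.lift (LinearMap.lsmul k K ∘ₗ χ.toLinearMap) ∘ₗ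
        LinearMap.lTensor K (LinearMap.mulLeft k g ∘ₗ HopfAlgebra.antipode k)) ∘ₗ comul₃

/-- The datum `(g₁, …, g_θ; χ₁, …, χ_θ)` defines a quantum linear space over `K`. -/
structure IsQLSDatum (g : Fin θ → K) (χ : Fin θ → K →ₐ[k] k) : Prop where
  isGroupLike : ∀ i, IsGroupLikeElem k (g i)
  isOfFinOrder : ∀ i, IsOfFinOrder (χ i (g i))
  one_lt_orderOf : ∀ i, 1 < orderOf (χ i (g i))
  comm_g : ∀ i j, g i * g j = g j * g i
  comm_χ : ∀ i j, convMul (χ i) (χ j) = convMul (χ j) (χ i)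
  yetterDrinfeld : ∀ i h, χ i h • g i = twistedConj (g i) (χ i) h
  braid : ∀ i j, i ≠ j → χ j (g i) * χ i (g j) = 1

/-- The defining relations: `x_i ^ N_i = 0`, where `N_i` is the order of `χ_i(g_i)`, and
`x_i x_j = χ_j(g_i) x_j x_i` for `i ≠ j`. -/
inductive QLSRel (g : Fin θ → K) (χ : Fin θ → K →ₐ[k] k) :
    FreeAlgebra k (Fin θ) → FreeAlgebra k (Fin θ) → Prop
  | pow (i : Fin θ) : QLSRel g χ (FreeAlgebra.ι k i ^ orderOf (χ i (g i))) 0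
  | comm (i j : Fin θ) (h : i ≠ j) : QLSRel g χ (FreeAlgebra.ι k i * FreeAlgebra.ι k j)
      (χ j (g i) • (FreeAlgebra.ι k j * FreeAlgebra.ι k i))

/-- The algebra generated by `x_1, …, x_θ` with the above relations. -/
abbrev QLSAlgebra (g : Fin θ → K) (χ : Fin θ → K →ₐ[k] k) : Type _ := RingQuot (QLSRel g χ)

/-- The generator `x_i`. -/
def QLSAlgebra.gen (g : Fin θ → K) (χ : Fin θ → K →ₐ[k] k) (i : Fin θ) : QLSAlgebra g χ :=
  RingQuot.mkAlgHom k (QLSRel g χ) (FreeAlgebra.ι k i)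

/-- `Q` is the braided Hopf algebra structure of the quantum linear space on the algebra with the
above presentation: the generators `x_i` are primitive and homogeneous with group-likes `g i` and
characters `χ i`. As all structure maps are determined by their values on generators, there is at
most one such structure. -/
structure IsQLSStructure (g : Fin θ → K) (χ : Fin θ → K →ₐ[k] k)
    (Q : BraidedHopfAlgebra k K (QLSAlgebra g χ)) : Prop where
  homogeneous : Q.IsHomogeneousFamily (QLSAlgebra.gen g χ) g χ
  primitive : ∀ i, QLSAlgebra.gen g χ i ∈ Q.primitives

/-- The braided Hopf algebra `B` is the quantum linear space `R(g₁, …, g_θ; χ₁, …, χ_θ)`: the datum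
defines a quantum linear space, and `B` is isomorphic to it as a braided Hopf algebra. -/
def IsQuantumLinearSpace {R : Type*} [Ring R] [Algebra k R] (B : BraidedHopfAlgebra k K R)
    (g : Fin θ → K) (χ : Fin θ → K →ₐ[k] k) : Prop :=
  IsQLSDatum g χ ∧ ∃ Q : BraidedHopfAlgebra k K (QLSAlgebra g χ), IsQLSStructure g χ Q ∧
    ∃ e : QLSAlgebra g χ ≃ₐ[k] R, Q.IsIso B e

end QuantumLinearSpaces

end YetterDrinfeld

end

open scoped TensorProduct

noncomputable section

namespace YetterDrinfeld

/-! ### Homogeneous elements: actions of group-likes, coactions on products, counit on primitives.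
-/

section Homogeneous

variable {k : Type*} [Field k] {K : Type*} [Ring K] [HopfAlgebra k K]
  {R : Type*} [Ring R] [Algebra k R]

/-! Write `q_i = χ_i(g_i)`. The engine is a counting argument on ordered monomials `x^n`. In `R ⊗ R`
the braiding only introduces scalars on homogeneous elements, so `Δ(x^n) = ∑ c(n,a) x^a ⊗ x^(n-a)`,
where `c(n,a) ≠ 0` as long as the `q_i`-factorials of the `n_i` do not vanish
(`exists_comul_orderedMonomial`). Convolving dual functionals then shows that all such monomials are
linearly independent (`linearIndepOn_orderedMonomial`).

Exponents `0` and `1` are always admissible, even when `N_i = 1`, so a trivial `q_i` would give more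
independent monomials than the dimension allows. Hence `N_i > 1`, and the monomials with `n_i < N_i`
form a basis.

The basis property forces the braiding condition: the convolution products of the functionals dual
to `x_i` and `x_j`, in either order, are both multiples of the functional dual to one and the same
monomial. The skew commutator `x_i x_j - χ_j(g_i) x_j x_i` has reduced coproduct `(1 - χ_j(g_i)
χ_i(g_j)) x_i ⊗ x_j`, which is compatible with this only if the scalar is zero
(`eq_zero_of_comul_eq`).

Now `x_i^(N_i)` and the skew commutators are primitive and homogeneous. If one of them were nonzero,
its degree would be that of some basis element `x_l`, and the braiding relations would give `q_l =
1`, a contradiction. So the defining relations hold in `R`. The presented algebra is spanned by the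
bounded monomials and these are independent in `R`, so the map to `R` is bijective. The braided Hopf
structure on the presented algebra is the one transported from `R`. -/

theorem braidedMul_tmul_of_eq (V : YDModule k K R) {a b c d : R} {u : K} {s : k}
    (hb : V.coact b = u ⊗ₜ b) (hc : V.act u c = s • c) :
    braidedMul V ((a ⊗ₜ b) ⊗ₜ (c ⊗ₜ d)) = s • ((a * c) ⊗ₜ (b * d)) := by
  simp [braidedMul, YDModule.braiding, hb, hc, TensorProduct.smul_tmul']

namespace BraidedHopfAlgebra

variable (B : BraidedHopfAlgebra k K R)

theorem act_mul_of_isGroupLikeElem {u : K} (hu : IsGroupLikeElem k u) (a b : R) :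
    B.act u (a * b) = B.act u a * B.act u b := by
  have := congr($(B.act_mul u) (a ⊗ₜ b))
  simpa [YDModule.diagAct, hu.comul_eq_tmul_self] using this

theorem act_one_of_isGroupLikeElem {u : K} (hu : IsGroupLikeElem k u) : B.act u 1 = 1 := by
  simp [B.act_one, hu.counit_eq_one]

theorem act_pow_of_isGroupLikeElem {u : K} (hu : IsGroupLikeElem k u) (a : R) (n : ℕ) :
    B.act u (a ^ n) = B.act u a ^ n := by
  induction n with
  | zero => simpa using B.act_one_of_isGroupLikeElem hu
  | succ n ih => rw [pow_succ, pow_succ, B.act_mul_of_isGroupLikeElem hu, ih]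

theorem act_mul_of_eq_smul {χ ψ : K →ₐ[k] k} {a b : R} (ha : ∀ h, B.act h a = χ h • a)
    (hb : ∀ h, B.act h b = ψ h • b) (h : K) : B.act h (a * b) = convMul χ ψ h • (a * b) := by
  have := congr($(B.act_mul h) (a ⊗ₜ b))
  simp only [LinearMap.comp_apply, LinearMap.mul'_apply] at this
  rw [this, YDModule.diagAct, convMul]
  simp only [LinearMap.comp_apply]
  induction Coalgebra.comul (R := k) h using TensorProduct.induction_on with
  | zero => simp
  | tmul u v => simp [ha, hb, smul_smul, mul_comm]
  | add s t hs ht => simp only [map_add, LinearMap.add_apply, hs, ht, add_smul]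

theorem coact_mul_of_eq {a b : R} {u v : K} (ha : B.coact a = u ⊗ₜ a) (hb : B.coact b = v ⊗ₜ b) :
    B.coact (a * b) = (u * v) ⊗ₜ (a * b) := by
  have := congr($(B.coact_mul) (a ⊗ₜ b))
  simpa [YDModule.codiagCoact, ha, hb] using this

theorem coact_pow_of_eq {a : R} {u : K} (ha : B.coact a = u ⊗ₜ a) (n : ℕ) :
    B.coact (a ^ n) = (u ^ n) ⊗ₜ (a ^ n) := by
  induction n with
  | zero => simpa using B.coact_one
  | succ n ih => rw [pow_succ, pow_succ, B.coact_mul_of_eq ih ha]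

/-- The counit axiom applied to `r ⊗ 1 + 1 ⊗ r` leaves `ε(r) 1 = 0`; a second application of `ε`,
with `ε(1) = 1`, turns this into `ε(r) = 0`. -/
theorem counit_eq_zero_of_mem_primitives {r : R} (hr : r ∈ B.primitives) : B.counit r = 0 := by
  rw [mem_primitives] at hr
  have h := congr($(B.rTensor_counit_comp_comul) r)
  simp only [LinearMap.comp_apply, hr, map_add, LinearMap.rTensor_tmul, B.counit_one,
    TensorProduct.mk_apply, add_eq_right] at h
  have h2 := congr(TensorProduct.lid k R $h)
  have h3 := congr(B.counit $h2)
  simpa [B.counit_one] using h3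

end BraidedHopfAlgebra

end Homogeneous

/-! ### Quantum integers, factorials and binomial coefficients. -/

section QBinomial

variable {k : Type*} [Field k]

/-- The `q`-integer `1 + q + ⋯ + q ^ (n - 1)`. -/
def qInt (q : k) (n : ℕ) : k := ∑ i ∈ Finset.range n, q ^ i

/-- The `q`-factorial. -/
def qFactorial (q : k) (n : ℕ) : k := ∏ i ∈ Finset.range n, qInt q (i + 1)

/-- The `q`-binomial coefficient. -/
def qBinom (q : k) : ℕ → ℕ → k
  | _, 0 => 1
  | 0, _ + 1 => 0
  | n + 1, a + 1 => qBinom q n a + q ^ (a + 1) * qBinom q n (a + 1)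

@[simp] theorem qBinom_zero_right (q : k) (n : ℕ) : qBinom q n 0 = 1 := by
  cases n <;> simp [qBinom]

theorem qBinom_succ_succ (q : k) (n a : ℕ) :
    qBinom q (n + 1) (a + 1) = qBinom q n a + q ^ (a + 1) * qBinom q n (a + 1) := by
  simp [qBinom]

theorem qBinom_eq_zero_of_lt (q : k) {n a : ℕ} (h : n < a) : qBinom q n a = 0 := by
  induction n generalizing a with
  | zero => obtain ⟨a, rfl⟩ := Nat.exists_eq_succ_of_ne_zero h.ne'; simp [qBinom]
  | succ n ih =>
    obtain ⟨a, rfl⟩ := Nat.exists_eq_succ_of_ne_zero (Nat.ne_zero_of_lt h)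
    rw [Nat.succ_eq_add_one, qBinom_succ_succ, ih (by omega), ih (by omega)]
    simp

@[simp] theorem qBinom_self (q : k) (n : ℕ) : qBinom q n n = 1 := by
  induction n with
  | zero => simp
  | succ n ih => rw [qBinom_succ_succ, ih, qBinom_eq_zero_of_lt q (Nat.lt_succ_self n)]; simp

theorem qInt_add (q : k) (m n : ℕ) : qInt q (m + n) = qInt q m + q ^ m * qInt q n := by
  simp [qInt, Finset.sum_range_add, Finset.mul_sum, pow_add]

theorem qFactorial_succ (q : k) (n : ℕ) :
    qFactorial q (n + 1) = qFactorial q n * qInt q (n + 1) := by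
  simp [qFactorial, Finset.prod_range_succ]

/-- Induction by the `q`-Pascal rule and `[a+b+2] = [a+1] + q^(a+1) [b+1]`. The division-free form
survives at roots of unity, where it yields both the nonvanishing of binomials below the order and
their vanishing at the order. -/
theorem qBinom_add_mul (q : k) (a b : ℕ) :
    qBinom q (a + b) a * (qFactorial q a * qFactorial q b) = qFactorial q (a + b) := by
  induction hn : a + b generalizing a b with
  | zero =>
    obtain ⟨rfl, rfl⟩ : a = 0 ∧ b = 0 := by omega
    simp [qFactorial]
  | succ n ih =>
    rcases a with _ | a
    · obtain rfl : b = n + 1 := by omega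
      simp [qFactorial]
    rcases b with _ | b
    · obtain rfl : a = n := by omega
      simp [qFactorial]
    have h1 := ih a (b + 1) (by omega)
    have h2 := ih (a + 1) b (by omega)
    have h3 := qInt_add q (a + 1) (b + 1)
    rw [show a + 1 + (b + 1) = n + 1 by omega] at h3
    rw [qFactorial_succ q b] at h1
    rw [qFactorial_succ q a] at h2
    rw [qFactorial_succ q n, qBinom_succ_succ, h3, qFactorial_succ q a, qFactorial_succ q b]
    linear_combination qInt q (a + 1) * h1 + q ^ (a + 1) * qInt q (b + 1) * h2

theorem qInt_eq_zero_iff_of_ne_one {q : k} (hq : q ≠ 1) (n : ℕ) : qInt q n = 0 ↔ q ^ n = 1 := by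
  rw [qInt, geom_sum_eq hq, div_eq_zero_iff, sub_eq_zero, sub_eq_zero]
  simp [hq]

/-- The factor `[i]` vanishes only if `q^i = 1` when `q ≠ 1`. The bound `max 2` records that `[0]! =
[1]! = 1` for every `q`, including `q = 1`; this extra room is what later excludes `N_i = 1`. -/
theorem qFactorial_ne_zero {q : k} {n : ℕ} (h : n < max 2 (orderOf q)) : qFactorial q n ≠ 0 := by
  rw [qFactorial, Finset.prod_ne_zero_iff]
  intro i hi
  rw [Finset.mem_range] at hi
  rcases i with _ | i
  · simp [qInt]
  have h' : i + 2 < orderOf q := by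
    rcases lt_max_iff.1 h with h | h <;> omega
  have hq : q ≠ 1 := by rintro rfl; simp at h'
  rw [Ne, qInt_eq_zero_iff_of_ne_one hq]
  exact pow_ne_one_of_lt_orderOf (by omega) h'

theorem qBinom_ne_zero {q : k} {n a : ℕ} (hn : qFactorial q n ≠ 0) (ha : a ≤ n) :
    qBinom q n a ≠ 0 := by
  obtain ⟨b, rfl⟩ := Nat.exists_eq_add_of_le ha
  intro h
  apply hn
  rw [← qBinom_add_mul, h, zero_mul]

/-- With `N` the order of `q`, `[N]! = 0` because `[N] = 0`, whereas `[a]!` and `[N-a]!` are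
nonzero. -/
theorem qBinom_orderOf_eq_zero {q : k} (hq : 1 < orderOf q) {a : ℕ} (h0 : 0 < a)
    (ha : a < orderOf q) : qBinom q (orderOf q) a = 0 := by
  obtain ⟨b, hb⟩ := Nat.exists_eq_add_of_le ha.le
  have h := qBinom_add_mul q a b
  rw [← hb] at h
  have h1 : qFactorial q (orderOf q) = 0 := by
    obtain ⟨m, hm⟩ := Nat.exists_eq_succ_of_ne_zero (show orderOf q ≠ 0 by omega)
    have hq1 : q ≠ 1 := by rintro rfl; simp at hq
    rw [hm, Nat.succ_eq_add_one, qFactorial_succ, (qInt_eq_zero_iff_of_ne_one hq1 _).2, mul_zero]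
    rw [← Nat.succ_eq_add_one, ← hm, pow_orderOf_eq_one]
  rw [h1] at h
  exact (mul_eq_zero.1 h).resolve_right (mul_ne_zero (qFactorial_ne_zero (lt_max_of_lt_right ha))
    (qFactorial_ne_zero (lt_max_of_lt_right (by omega))))

end QBinomial

/-! ### Ordered monomials in a monoid. -/

section OrderedMonomials

variable {A : Type*} [Monoid A]

/-- The ordered monomial `x₁ ^ n₁ ⋯ x_m ^ n_m`. -/
def orderedMonomial {m : ℕ} (x : Fin m → A) (n : Fin m → ℕ) : A :=
  (List.ofFn fun i => x i ^ n i).prod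

theorem orderedMonomial_fin_zero (x : Fin 0 → A) (n : Fin 0 → ℕ) : orderedMonomial x n = 1 := by
  simp [orderedMonomial]

theorem orderedMonomial_succ {m : ℕ} (x : Fin (m + 1) → A) (n : Fin (m + 1) → ℕ) :
    orderedMonomial x n =
      x 0 ^ n 0 * orderedMonomial (fun i => x i.succ) (fun i => n i.succ) := by
  simp [orderedMonomial, List.ofFn_succ]

@[simp] theorem orderedMonomial_zero {m : ℕ} (x : Fin m → A) : orderedMonomial x 0 = 1 := by
  induction m with
  | zero => exact orderedMonomial_fin_zero x 0
  | succ m ih => simpa [orderedMonomial_succ] using! ih fun i => x i.succ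

@[simp] theorem orderedMonomial_single {m : ℕ} (x : Fin m → A) (i : Fin m) :
    orderedMonomial x (Pi.single i 1) = x i := by
  induction m with
  | zero => exact i.elim0
  | succ m ih =>
    rw [orderedMonomial_succ]
    cases i using Fin.cases with
    | zero =>
      have : (fun i : Fin m => (Pi.single 0 1 : Fin (m + 1) → ℕ) i.succ) = 0 := by
        ext i; simp
      rw [this]; simp
    | succ i =>
      have : (fun j : Fin m => (Pi.single i.succ 1 : Fin (m + 1) → ℕ) j.succ) = Pi.single i 1 := by
        ext j; simp [Pi.single_apply]
      rw [this, ih]; simp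

theorem map_orderedMonomial {A' F : Type*} [Monoid A'] [FunLike F A A'] [MonoidHomClass F A A']
    (f : F) {m : ℕ} (x : Fin m → A) (n : Fin m → ℕ) :
    f (orderedMonomial x n) = orderedMonomial (fun i => f (x i)) n := by
  simp [orderedMonomial, map_list_prod, List.map_ofFn, Function.comp_def]

theorem sum_Iic_fin_succ {M : Type*} [AddCommMonoid M] {m : ℕ} (n : Fin (m + 1) → ℕ)
    (f : (Fin (m + 1) → ℕ) → M) :
    ∑ a ∈ Finset.Iic n, f a =
      ∑ a₀ ∈ Finset.range (n 0 + 1), ∑ a ∈ Finset.Iic (fun i => n i.succ), f (Fin.cons a₀ a) := by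
  rw [← Finset.sum_product']
  refine Finset.sum_nbij' (fun a => (a 0, fun i => a i.succ)) (fun p => Fin.cons p.1 p.2)
    ?_ ?_ ?_ ?_ ?_
  · intro a ha
    rw [Finset.mem_Iic] at ha
    simp only [Finset.mem_product, Finset.mem_range, Finset.mem_Iic]
    exact ⟨Nat.lt_succ_of_le (ha 0), fun i => ha i.succ⟩
  · intro p hp
    simp only [Finset.mem_product, Finset.mem_range, Finset.mem_Iic] at hp
    rw [Finset.mem_Iic]
    intro i
    cases i using Fin.cases with
    | zero => simpa using Nat.le_of_lt_succ hp.1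
    | succ i => simpa using hp.2 i
  · intro a _
    exact Fin.cons_self_tail a
  · intro p _
    simp
  · intro a _
    exact congrArg f (Fin.cons_self_tail a).symm

end OrderedMonomials

/-! ### Comultiplication of powers and of ordered monomials. -/

namespace BraidedHopfAlgebra

variable {k : Type*} [Field k] {K : Type*} [Ring K] [HopfAlgebra k K]
  {R : Type*} [Ring R] [Algebra k R] (B : BraidedHopfAlgebra k K R)

/-- The quantum binomial theorem: `(1 ⊗ r)(r ⊗ 1) = q (r ⊗ 1)(1 ⊗ r)` in the braided tensor square.
-/
theorem comul_pow_of_primitive {r : R} {g : K} {q : k} (hg : IsGroupLikeElem k g)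
    (hr : r ∈ B.primitives) (hco : B.coact r = g ⊗ₜ r) (hact : B.act g r = q • r) (n : ℕ) :
    B.comul (r ^ n) =
      ∑ a ∈ Finset.range (n + 1), qBinom q n a • ((r ^ a) ⊗ₜ[k] (r ^ (n - a))) := by
  rw [← Finset.Nat.sum_antidiagonal_eq_sum_range_succ
    (f := fun a b => qBinom q n a • ((r ^ a) ⊗ₜ[k] (r ^ b)))]
  rw [mem_primitives] at hr
  have hpow (a : ℕ) : B.act g (r ^ a) = q ^ a • r ^ a := by
    rw [B.act_pow_of_isGroupLikeElem hg, hact, smul_pow]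
  have hone : B.coact 1 = (1 : K) ⊗ₜ (1 : R) := B.coact_one
  have hact1 (a : R) : B.act 1 a = (1 : k) • a := by simp
  induction n with
  | zero => simpa using B.comul_one
  | succ n ih =>
    rw [pow_succ', B.comul_mul, ih, hr, TensorProduct.tmul_sum, map_sum]
    have h (p : ℕ × ℕ) : braidedMul B.toYDModule ((r ⊗ₜ[k] 1 + 1 ⊗ₜ[k] r) ⊗ₜ[k]
        (qBinom q n p.1 • ((r ^ p.1) ⊗ₜ[k] (r ^ p.2)))) =
        qBinom q n p.1 • ((r ^ (p.1 + 1)) ⊗ₜ[k] (r ^ p.2)) +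
          (qBinom q n p.1 * q ^ p.1) • ((r ^ p.1) ⊗ₜ[k] (r ^ (p.2 + 1))) := by
      rw [TensorProduct.tmul_smul, map_smul, TensorProduct.add_tmul, map_add,
        braidedMul_tmul_of_eq _ hone (hact1 _), braidedMul_tmul_of_eq _ hco (hpow _),
        smul_add, smul_smul, smul_smul]
      simp [pow_succ']
    simp only [h]
    -- Both ways of splitting an end term off the antidiagonal of `n + 1` are compared; the end term
    -- with first index `n + 1` vanishes, which aligns the two halves of the Pascal rule.
    have h1 := Finset.Nat.sum_antidiagonal_succ (n := n)
      (f := fun p : ℕ × ℕ => (qBinom q n p.1 * q ^ p.1) • ((r ^ p.1) ⊗ₜ[k] (r ^ p.2)))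
    rw [Finset.Nat.sum_antidiagonal_succ'] at h1
    simp only [qBinom_eq_zero_of_lt q (Nat.lt_succ_self n), zero_mul, zero_smul, zero_add] at h1
    rw [Finset.sum_add_distrib, h1, Finset.Nat.sum_antidiagonal_succ]
    simp only [qBinom_succ_succ, add_smul, Finset.sum_add_distrib]
    simp only [qBinom_zero_right, pow_zero, one_mul, one_smul, mul_comm (q ^ _)]
    abel

theorem act_orderedMonomial_of_isGroupLikeElem {m : ℕ} {x : Fin m → R} {g : Fin m → K}
    {χ : Fin m → K →ₐ[k] k} (hx : B.IsHomogeneousFamily x g χ) {u : K} (hu : IsGroupLikeElem k u)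
    (n : Fin m → ℕ) :
    B.act u (orderedMonomial x n) = (∏ i, χ i u ^ n i) • orderedMonomial x n := by
  induction m with
  | zero => simpa [orderedMonomial_fin_zero] using B.act_one_of_isGroupLikeElem hu
  | succ m ih =>
    have hx' : B.IsHomogeneousFamily (fun i : Fin m => x i.succ) (fun i => g i.succ)
        (fun i => χ i.succ) :=
      ⟨fun i => hx.isGroupLike _, fun i => hx.coact_eq _, fun i => hx.act_eq _⟩
    rw [orderedMonomial_succ, B.act_mul_of_isGroupLikeElem hu, ih hx',
      B.act_pow_of_isGroupLikeElem hu, hx.act_eq, Fin.prod_univ_succ, smul_pow, smul_mul_smul_comm]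

/-- Only the shape of the expansion and the nonvanishing of its coefficients matter later. No
commutation relation between the `x_i` is needed: the factors of `Δ(x_0^(n_0))` stand to the left of
those of the remaining monomial, so the product is already ordered up to the scalars of the
braiding. These are nonzero because group-likes are units. -/
theorem exists_comul_orderedMonomial {m : ℕ} {x : Fin m → R} {g : Fin m → K}
    {χ : Fin m → K →ₐ[k] k} (hx : B.IsHomogeneousFamily x g χ) (hP : ∀ i, x i ∈ B.primitives) :
    ∃ c : (Fin m → ℕ) → (Fin m → ℕ) → k,
      (∀ n a, a ≤ n → (∀ i, qFactorial (χ i (g i)) (n i) ≠ 0) → c n a ≠ 0) ∧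
      ∀ n, B.comul (orderedMonomial x n) =
        ∑ a ∈ Finset.Iic n, c n a • (orderedMonomial x a ⊗ₜ[k] orderedMonomial x (n - a)) := by
  induction m with
  | zero =>
    refine ⟨fun _ _ => 1, fun _ _ _ _ => one_ne_zero, fun n => ?_⟩
    have : Finset.Iic n = {0} := by ext a; simp [Subsingleton.elim a n, Subsingleton.elim 0 n]
    rw [this]
    simpa [orderedMonomial_fin_zero] using B.comul_one
  | succ m ih =>
    have hx' : B.IsHomogeneousFamily (fun i : Fin m => x i.succ) (fun i => g i.succ)
        (fun i => χ i.succ) :=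
      ⟨fun i => hx.isGroupLike _, fun i => hx.coact_eq _, fun i => hx.act_eq _⟩
    obtain ⟨c, hc, hΔ⟩ := ih hx' fun i => hP _
    -- The middle product is the scalar by which `g_0^(n_0 - a_0)`, the degree of the right tensor
    -- factor `x_0^(n_0 - a_0)`, acts on the tail monomial it is braided past.
    refine ⟨fun n a => qBinom (χ 0 (g 0)) (n 0) (a 0) *
      (∏ i : Fin m, χ i.succ (g 0 ^ (n 0 - a 0)) ^ a i.succ) *
      c (fun i => n i.succ) (fun i => a i.succ), fun n a ha hn => ?_, fun n => ?_⟩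
    · refine mul_ne_zero (mul_ne_zero (qBinom_ne_zero (hn 0) (ha 0)) ?_)
        (hc _ _ (fun i => ha i.succ) fun i => hn i.succ)
      refine Finset.prod_ne_zero_iff.2 fun i _ => pow_ne_zero _ ?_
      rw [map_pow]
      exact pow_ne_zero _ ((hx.isGroupLike 0).isUnit.map (χ i.succ)).ne_zero
    · rw [orderedMonomial_succ, B.comul_mul, hΔ,
        B.comul_pow_of_primitive (hx.isGroupLike 0) (hP 0) (hx.coact_eq 0) (hx.act_eq 0 _),
        TensorProduct.sum_tmul, map_sum, sum_Iic_fin_succ]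
      refine Finset.sum_congr rfl fun a₀ _ => ?_
      rw [TensorProduct.tmul_sum, map_sum]
      refine Finset.sum_congr rfl fun a _ => ?_
      have hsub : orderedMonomial x (n - Fin.cons a₀ a) = x 0 ^ (n 0 - a₀) *
          orderedMonomial (fun i => x i.succ) ((fun i => n i.succ) - a) :=
        orderedMonomial_succ x _
      rw [← TensorProduct.smul_tmul', TensorProduct.tmul_smul, map_smul, map_smul,
        braidedMul_tmul_of_eq _ (B.coact_pow_of_eq (hx.coact_eq 0) _)
          (B.act_orderedMonomial_of_isGroupLikeElem hx' ((hx.isGroupLike 0).pow) a),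
        smul_smul, smul_smul, orderedMonomial_succ x (Fin.cons a₀ a), hsub]
      simp only [Fin.cons_zero, Fin.cons_succ]
      congr 1
      ring

end BraidedHopfAlgebra

/-! ### Exponent vectors and dual functionals. -/

section Exponents

variable {m : ℕ}

theorem eq_zero_or_eq_single_of_sum_le_one {n : Fin m → ℕ} (h : ∑ i, n i ≤ 1) :
    n = 0 ∨ ∃ i, n = Pi.single i 1 := by
  rw [or_iff_not_imp_left]
  intro h0
  obtain ⟨i, hi⟩ := Function.ne_iff.1 h0
  refine ⟨i, ?_⟩
  rw [Pi.zero_apply] at hi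
  have h1 := Finset.add_sum_erase Finset.univ n (Finset.mem_univ i)
  have h2 : ∑ j ∈ Finset.univ.erase i, n j = 0 := by omega
  rw [Finset.sum_eq_zero_iff] at h2
  ext j
  by_cases hj : j = i
  · subst hj; simp; omega
  · simp [hj, h2 j (by simp [hj])]

theorem exists_add_of_one_lt_sum {n : Fin m → ℕ} (h : 1 < ∑ i, n i) :
    ∃ a a', a ≠ 0 ∧ a' ≠ 0 ∧ a + a' = n := by
  have h0 : n ≠ 0 := by rintro rfl; simp at h
  obtain ⟨i, hi⟩ := Function.ne_iff.1 h0
  rw [Pi.zero_apply] at hi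
  have hle : Pi.single i 1 ≤ n := by
    intro j
    by_cases hj : j = i
    · subst hj; simp; omega
    · simp [hj]
  have hadd := add_tsub_cancel_of_le hle
  refine ⟨Pi.single i 1, n - Pi.single i 1, ?_, ?_, hadd⟩
  · intro h; simpa using congrFun h i
  · intro h'
    rw [h', add_zero] at hadd
    rw [← hadd] at h
    simp at h

/-- Coordinates on the span are extended by a left inverse. Indices outside `s` get the zero
functional, so the vanishing clause needs no membership condition on `a`. -/
theorem exists_dual_of_linearIndepOn {k M ι : Type*} [Field k] [AddCommGroup M] [Module k M]
    {v : ι → M} {s : Set ι} (h : LinearIndepOn k v s) :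
    ∃ D : ι → M →ₗ[k] k, (∀ a ∈ s, D a (v a) = 1) ∧ ∀ a, ∀ b ∈ s, b ≠ a → D a (v b) = 0 := by
  classical
  obtain ⟨f, hf⟩ := LinearMap.exists_leftInverse_of_injective
    (Finsupp.linearCombination k fun a : s => v a) (LinearMap.ker_eq_bot.2 h)
  have hf' (a : s) : f (v a) = Finsupp.single a 1 := by
    simpa using congr($hf (Finsupp.single a 1))
  refine ⟨fun a => if ha : a ∈ s then Finsupp.lapply ⟨a, ha⟩ ∘ₗ f else 0, fun a ha => ?_,
    fun a b hb hab => ?_⟩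
  · simp [ha, hf' ⟨a, ha⟩]
  · by_cases ha : a ∈ s
    · simp [ha, hf' ⟨b, hb⟩, hab]
    · simp [ha]

theorem apply_eq_zero_of_linearCombination_eq_zero {k M ι : Type*} [Field k] [AddCommGroup M]
    [Module k M] {v : ι → M} {s : Set ι} {l : ι →₀ k} (hl : l ∈ Finsupp.supported k k s)
    (h0 : Finsupp.linearCombination k v l = 0) (φ : M →ₗ[k] k) {a : ι} (ha : φ (v a) ≠ 0)
    (hb : ∀ b ∈ s, b ≠ a → φ (v b) = 0) : l a = 0 := by
  have h := congr(φ $h0)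
  rw [Finsupp.linearCombination_apply, Finsupp.sum, map_sum, map_zero,
    Finset.sum_eq_single a] at h
  · simpa [ha] using h
  · intro b hbl hba
    rw [map_smul, hb b (hl hbl) hba, smul_zero]
  · intro h
    rw [Finsupp.notMem_support_iff.1 h, zero_smul, map_zero]

end Exponents

section QFactorial

/-- Makes the set of admissible exponents downward closed, as the induction on degree requires. -/
theorem qFactorial_ne_zero_of_le {k : Type*} [Field k] {q : k} {n n' : ℕ} (h : n ≤ n')
    (hn : qFactorial q n' ≠ 0) : qFactorial q n ≠ 0 := by
  obtain ⟨b, rfl⟩ := Nat.exists_eq_add_of_le h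
  rw [← qBinom_add_mul] at hn
  exact left_ne_zero_of_mul (right_ne_zero_of_mul hn)

end QFactorial

/-! ### Convolution of functionals, linear independence, and consequences of minimal dimension. -/

namespace BraidedHopfAlgebra

variable {k : Type*} [Field k] {K : Type*} [Ring K] [HopfAlgebra k K]
  {R : Type*} [Ring R] [Algebra k R] (B : BraidedHopfAlgebra k K R)

/-- The convolution product `r ↦ φ(r₍₁₎) ψ(r₍₂₎)` of two linear functionals. -/
def dualMul (φ ψ : R →ₗ[k] k) : R →ₗ[k] k :=
  LinearMap.mul' k k ∘ₗ TensorProduct.map φ ψ ∘ₗ B.comul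

/-- The extreme terms `x^b ⊗ 1` and `1 ⊗ x^b` die because both functionals kill `1`. Hence only
values on exponents strictly below `b` are constrained, so functionals dual to monomials of lower
degree can be used to test monomials of the next degree. -/
theorem dualMul_apply_of_comul_eq_sum {m : ℕ} {x : Fin m → R} {c : (Fin m → ℕ) → k}
    {b : Fin m → ℕ} (hc : B.comul (orderedMonomial x b) =
      ∑ a ∈ Finset.Iic b, c a • (orderedMonomial x a ⊗ₜ[k] orderedMonomial x (b - a)))
    {φ ψ : R →ₗ[k] k} {a a' : Fin m → ℕ} (hφ1 : φ 1 = 0) (hψ1 : ψ 1 = 0)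
    (hφ : ∀ d < b, d ≠ a → φ (orderedMonomial x d) = 0)
    (hψ : ∀ d < b, d ≠ a' → ψ (orderedMonomial x d) = 0) :
    B.dualMul φ ψ (orderedMonomial x b) = if b = a + a' then
      c a * (φ (orderedMonomial x a) * ψ (orderedMonomial x a')) else 0 := by
  simp only [dualMul, LinearMap.comp_apply, hc, map_sum, map_smul, TensorProduct.map_tmul,
    LinearMap.mul'_apply, smul_eq_mul]
  have key : ∀ d ∈ Finset.Iic b, ¬ (d = a ∧ b - d = a') →
      c d * (φ (orderedMonomial x d) * ψ (orderedMonomial x (b - d))) = 0 := by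
    intro d hd hda
    rw [Finset.mem_Iic] at hd
    rcases eq_or_lt_of_le hd with rfl | hlt
    · simp [hψ1]
    by_cases h : d = a
    · have h0 : b - d ≤ b := tsub_le_self
      rcases eq_or_lt_of_le h0 with h0 | h0
      · have : d = 0 := by
          have h3 := tsub_add_cancel_of_le hd
          rw [h0] at h3
          simpa using h3
        simp [this, hφ1]
      · rw [hψ _ h0 (fun h' => hda ⟨h, h'⟩)]; simp
    · rw [hφ d hlt h]; simp
  split_ifs with hb
  · subst hb
    rw [Finset.sum_eq_single a]
    · simp
    · intro d hd hda
      exact key d hd (fun h => hda h.1)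
    · intro h
      exact absurd (Finset.mem_Iic.2 le_self_add) h
  · refine Finset.sum_eq_zero fun d hd => key d hd ?_
    rintro ⟨rfl, rfl⟩
    exact hb (add_tsub_cancel_of_le (Finset.mem_Iic.1 hd)).symm

variable {m : ℕ} {x : Fin m → R} {g : Fin m → K} {χ : Fin m → K →ₐ[k] k}

theorem linearIndepOn_orderedMonomial_sum_le_one (hP : ∀ i, x i ∈ B.primitives)
    (hli : LinearIndependent k x) :
    LinearIndepOn k (orderedMonomial x) {n | ∑ i, n i ≤ 1} := by
  obtain ⟨D, hD1, hD0⟩ := exists_dual_of_linearIndepOn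
    (linearIndepOn_univ_iff.2 hli)
  rw [linearIndepOn_iff]
  intro l hl h0
  ext a
  by_cases ha : a ∈ l.support
  swap
  · simpa using ha
  have ha1 := hl ha
  rcases eq_zero_or_eq_single_of_sum_le_one ha1 with rfl | ⟨i, rfl⟩
  · refine apply_eq_zero_of_linearCombination_eq_zero hl h0 B.counit ?_ ?_
    · simp [B.counit_one]
    · intro b hb hb0
      obtain ⟨i, rfl⟩ := (eq_zero_or_eq_single_of_sum_le_one hb).resolve_left hb0
      simpa using B.counit_eq_zero_of_mem_primitives (hP i)
  -- Subtracting a multiple of the counit makes the functional kill `1` without changing it on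
  -- primitive elements.
  · refine apply_eq_zero_of_linearCombination_eq_zero hl h0 (D i - D i 1 • B.counit) ?_ ?_
    · simp [hD1 i, B.counit_eq_zero_of_mem_primitives (hP i)]
    · intro b hb hb0
      rcases eq_zero_or_eq_single_of_sum_le_one hb with rfl | ⟨j, rfl⟩
      · simp [B.counit_one]
      · have hji : j ≠ i := by rintro rfl; exact hb0 rfl
        simp [hD0 i j trivial hji, B.counit_eq_zero_of_mem_primitives (hP j)]

/-- The ordered monomials in linearly independent homogeneous primitive elements are linearly
independent as long as the `q`-factorials of the exponents do not vanish. -/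
theorem linearIndepOn_orderedMonomial (hx : B.IsHomogeneousFamily x g χ)
    (hP : ∀ i, x i ∈ B.primitives) (hli : LinearIndependent k x) :
    LinearIndepOn k (orderedMonomial x) {n | ∀ i, qFactorial (χ i (g i)) (n i) ≠ 0} := by
  obtain ⟨c, hc, hΔ⟩ := B.exists_comul_orderedMonomial hx hP
  -- The induction starts at degree at most `1`, since exponents of degree `0` or `1` are not sums
  -- of two nonzero exponents.
  have hdeg (d : ℕ) : LinearIndepOn k (orderedMonomial x)
      {n | (∀ i, qFactorial (χ i (g i)) (n i) ≠ 0) ∧ ∑ i, n i ≤ d + 1} := by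
    induction d with
    | zero => exact (B.linearIndepOn_orderedMonomial_sum_le_one hP hli).mono fun n hn => hn.2
    | succ d ih =>
      obtain ⟨D, hD1, hD0⟩ := exists_dual_of_linearIndepOn ih
      have hlt {a b : Fin m → ℕ} (hb : b ∈ {n : Fin m → ℕ |
          (∀ i, qFactorial (χ i (g i)) (n i) ≠ 0) ∧ ∑ i, n i ≤ d + 1 + 1}) (hab : a < b) :
          a ∈ {n : Fin m → ℕ | (∀ i, qFactorial (χ i (g i)) (n i) ≠ 0) ∧ ∑ i, n i ≤ d + 1} :=
        ⟨fun i => qFactorial_ne_zero_of_le (hab.le i) (hb.1 i),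
          Nat.le_of_lt_succ ((Fintype.sum_strictMono hab).trans_le hb.2)⟩
      have h0mem : (0 : Fin m → ℕ) ∈ {n : Fin m → ℕ |
          (∀ i, qFactorial (χ i (g i)) (n i) ≠ 0) ∧ ∑ i, n i ≤ d + 1} := by
        simp [qFactorial]
      have hD00 {a : Fin m → ℕ} (ha : a ≠ 0) : D a 1 = 0 := by
        simpa using hD0 a 0 h0mem ha.symm
      rw [linearIndepOn_iff]
      intro l hl h0
      -- Every exponent of degree above `1` splits as `a + a'` with both parts strictly smaller; `D
      -- a * D a'` takes the value `c(n,a) ≠ 0` on `x^n` and vanishes on the other monomials,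
      -- isolating the coefficient of `x^n`.
      have htop : ∀ n, 1 < ∑ i, n i → l n = 0 := by
        intro n hn
        by_cases hnl : n ∈ l.support
        swap
        · simpa using hnl
        have hns := hl hnl
        obtain ⟨a, a', ha, ha', rfl⟩ := exists_add_of_one_lt_sum hn
        have hA := hlt hns (lt_add_of_pos_right a (pos_iff_ne_zero.2 ha'))
        have hA' := hlt hns (lt_add_of_pos_left a' (pos_iff_ne_zero.2 ha))
        have key {b : Fin m → ℕ} (hb : b ∈ {n : Fin m → ℕ |
            (∀ i, qFactorial (χ i (g i)) (n i) ≠ 0) ∧ ∑ i, n i ≤ d + 1 + 1}) :=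
          B.dualMul_apply_of_comul_eq_sum (hΔ b) (hD00 ha) (hD00 ha')
            (fun e he hea => hD0 a e (hlt hb he) hea) (fun e he hea => hD0 a' e (hlt hb he) hea)
        refine apply_eq_zero_of_linearCombination_eq_zero hl h0 (B.dualMul (D a) (D a')) ?_ ?_
        · rw [key hns, if_pos rfl, hD1 a hA, hD1 a' hA']
          simpa using hc _ _ le_self_add hns.1
        · intro b hb hbn
          rw [key hb, if_neg hbn]
      refine linearIndepOn_iff.1 ih l ?_ h0
      intro n hn
      refine ⟨(hl hn).1, ?_⟩
      by_contra hlt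
      exact Finsupp.mem_support_iff.1 hn (htop n (by omega))
  rw [linearIndepOn_iff]
  intro l hl h0
  -- A single linear combination has bounded degree.
  refine linearIndepOn_iff.1 (hdeg (l.support.sup fun n => ∑ i, n i)) l (fun n hn => ⟨hl hn, ?_⟩) h0
  exact (Finset.le_sup (f := fun n : Fin m → ℕ => ∑ i, n i) hn).trans (Nat.le_succ _)

theorem linearIndependent_orderedMonomial (hx : B.IsHomogeneousFamily x g χ)
    (hP : ∀ i, x i ∈ B.primitives) (hli : LinearIndependent k x) {M : Fin m → ℕ}
    (hM : ∀ i, M i ≤ max 2 (orderOf (χ i (g i)))) :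
    LinearIndependent k fun n : (i : Fin m) → Fin (M i) =>
      orderedMonomial x fun i => (n i : ℕ) := by
  refine (B.linearIndepOn_orderedMonomial hx hP hli).comp
    (fun n : (i : Fin m) → Fin (M i) => ⟨fun i => (n i : ℕ),
      fun i => qFactorial_ne_zero ((n i).2.trans_le (hM i))⟩) ?_
  intro n n' h
  ext i
  exact congrFun (congrArg Subtype.val h) i

/-- Independence with exponents below `max 2 N_j` gives `∏ max 2 N_j ≤ ∏ N_j`, which is strictly
violated if some `N_i = 1`. -/
theorem one_lt_orderOf_of_rank_eq (hx : B.IsHomogeneousFamily x g χ)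
    (hP : ∀ i, x i ∈ B.primitives) (hli : LinearIndependent k x)
    (hord : ∀ i, IsOfFinOrder (χ i (g i)))
    (hdim : Module.rank k R = ((∏ i, orderOf (χ i (g i)) : ℕ) : Cardinal)) (i : Fin m) :
    1 < orderOf (χ i (g i)) := by
  have : Module.Finite k R := Module.finite_of_rank_eq_nat hdim
  have h := (B.linearIndependent_orderedMonomial hx hP hli
    fun i => le_refl (max 2 (orderOf (χ i (g i))))).fintype_card_le_finrank
  rw [Module.finrank_eq_of_rank_eq hdim, Fintype.card_pi] at h
  simp only [Fintype.card_fin] at h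
  by_contra hi
  refine h.not_gt (Finset.prod_lt_prod (fun j _ => (hord j).orderOf_pos)
    (fun j _ => le_max_right _ _) ⟨i, Finset.mem_univ i, ?_⟩)
  exact lt_max_of_lt_left (by omega)

/-- If the dimension is minimal, the ordered monomials form a basis. -/
theorem span_orderedMonomial_eq_top (hx : B.IsHomogeneousFamily x g χ)
    (hP : ∀ i, x i ∈ B.primitives) (hli : LinearIndependent k x)
    (hord : ∀ i, IsOfFinOrder (χ i (g i)))
    (hdim : Module.rank k R = ((∏ i, orderOf (χ i (g i)) : ℕ) : Cardinal)) :
    Submodule.span k (Set.range fun n : (i : Fin m) → Fin (orderOf (χ i (g i))) =>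
      orderedMonomial x fun i => (n i : ℕ)) = ⊤ := by
  have : Module.Finite k R := Module.finite_of_rank_eq_nat hdim
  have (i : Fin m) : NeZero (orderOf (χ i (g i))) := ⟨(hord i).orderOf_pos.ne'⟩
  refine (B.linearIndependent_orderedMonomial hx hP hli
    fun i => le_max_right 2 (orderOf (χ i (g i)))).span_eq_top_of_card_eq_finrank ?_
  rw [Module.finrank_eq_of_rank_eq hdim, Fintype.card_pi]
  simp

/-- If the dimension is minimal, the term `x i ⊗ x j` cannot occur alone in a reduced
comultiplication. -/
theorem eq_zero_of_comul_eq (hx : B.IsHomogeneousFamily x g χ)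
    (hP : ∀ i, x i ∈ B.primitives) (hli : LinearIndependent k x)
    (hord : ∀ i, IsOfFinOrder (χ i (g i)))
    (hdim : Module.rank k R = ((∏ i, orderOf (χ i (g i)) : ℕ) : Cardinal))
    {i j : Fin m} (hij : i ≠ j) {y : R} {t : k}
    (hy : B.comul y = y ⊗ₜ 1 + 1 ⊗ₜ y + t • (x i ⊗ₜ x j)) : t = 0 := by
  obtain ⟨c, hc, hΔ⟩ := B.exists_comul_orderedMonomial hx hP
  obtain ⟨D, hD1, hD0⟩ := exists_dual_of_linearIndepOn (B.linearIndepOn_orderedMonomial hx hP hli)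
  have hbox (n : (i : Fin m) → Fin (orderOf (χ i (g i)))) (l : Fin m) :
      qFactorial (χ l (g l)) (n l) ≠ 0 := qFactorial_ne_zero (lt_max_of_lt_right (n l).2)
  have hsingle (l : Fin m) : (Pi.single l 1 : Fin m → ℕ) ∈
      {n : Fin m → ℕ | ∀ i, qFactorial (χ i (g i)) (n i) ≠ 0} := by
    intro j
    refine qFactorial_ne_zero (lt_max_of_lt_left (lt_of_le_of_lt ?_ one_lt_two))
    simp only [Pi.single_apply]
    split_ifs <;> simp
  have hne (l : Fin m) : (Pi.single l 1 : Fin m → ℕ) ≠ 0 := by simp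
  have hone (l : Fin m) : D (Pi.single l 1) 1 = 0 := by
    simpa using hD0 (Pi.single l 1) 0 (by simp [qFactorial]) (hne l).symm
  have hadd : ∀ l, qFactorial (χ l (g l)) ((Pi.single i 1 + Pi.single j 1 : Fin m → ℕ) l) ≠ 0 := by
    intro l
    refine qFactorial_ne_zero (lt_max_of_lt_left (lt_of_le_of_lt ?_ one_lt_two))
    simp only [Pi.add_apply, Pi.single_apply]
    split_ifs with h1 h2 <;> first | exact absurd (h1.symm.trans h2) hij | simp
  -- Used for `(i, j)` and for `(j, i)`: since the bounded monomials span, both convolution products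
  -- are multiples of the functional dual to the monomial with exponent `e_i + e_j`.
  have hdual {i' j' : Fin m} (h : (Pi.single i' 1 + Pi.single j' 1 : Fin m → ℕ) =
      Pi.single i 1 + Pi.single j 1) (r : R) :
      B.dualMul (D (Pi.single i' 1)) (D (Pi.single j' 1)) r =
        c (Pi.single i 1 + Pi.single j 1) (Pi.single i' 1) *
          D (Pi.single i 1 + Pi.single j 1) r := by
    have : B.dualMul (D (Pi.single i' 1)) (D (Pi.single j' 1)) =
        c (Pi.single i 1 + Pi.single j 1) (Pi.single i' 1) •
          D (Pi.single i 1 + Pi.single j 1) := by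
      refine LinearMap.ext_on_range (B.span_orderedMonomial_eq_top hx hP hli hord hdim)
        fun n => ?_
      rw [B.dualMul_apply_of_comul_eq_sum (hΔ _) (hone i') (hone j')
        (fun e he hea => hD0 _ e (fun l => qFactorial_ne_zero_of_le (he.le l) (hbox n l)) hea)
        (fun e he hea => hD0 _ e (fun l => qFactorial_ne_zero_of_le (he.le l) (hbox n l)) hea),
        hD1 _ (hsingle i'), hD1 _ (hsingle j'), h]
      split_ifs with hn
      · rw [hn, LinearMap.smul_apply, hD1 _ hadd]; simp
      · rw [LinearMap.smul_apply, hD0 _ _ (hbox n) hn, smul_zero]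
    rw [this]; rfl
  have hDx (l l' : Fin m) (h : l' ≠ l) : D (Pi.single l 1) (x l') = 0 := by
    have := hD0 (Pi.single l 1) (Pi.single l' 1) (hsingle l')
      (fun h' => by simpa [Pi.single_apply, h] using congrFun h' l')
    simpa using this
  have hDx1 (l : Fin m) : D (Pi.single l 1) (x l) = 1 := by
    simpa using hD1 _ (hsingle l)
  -- At `y` the product in the order `(j, i)` is `0` and in the order `(i, j)` is `t`. The first,
  -- with a nonzero coefficient, shows that the common dual functional vanishes at `y`; the second
  -- then gives `t = 0`.
  have h1 := hdual (add_comm (Pi.single j 1) (Pi.single i 1)) y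
  have h2 := hdual rfl y
  have hcj := hc _ (Pi.single j 1) le_add_self hadd
  simp only [dualMul, LinearMap.comp_apply, hy, map_add, map_smul, TensorProduct.map_tmul,
    LinearMap.mul'_apply, hone, hDx _ _ hij, hDx1, mul_zero, zero_mul, add_zero, mul_one,
    smul_eq_mul, zero_add] at h1 h2
  rw [h2, (mul_eq_zero.1 h1.symm).resolve_left hcj, mul_zero]

end BraidedHopfAlgebra

/-! ### Comparing coefficients in tensors and the Yetter-Drinfeld compatibility on eigenvectors. -/

section Cancel

theorem tmul_left_cancel_of_apply_ne_zero {k M N : Type*} [Field k] [AddCommGroup M] [Module k M]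
    [AddCommGroup N] [Module k N] {a b : M} {n : N} {D : N →ₗ[k] k} (hD : D n ≠ 0)
    (h : a ⊗ₜ[k] n = b ⊗ₜ[k] n) : a = b := by
  have := congr(TensorProduct.rid k M (LinearMap.lTensor M D $h))
  simp only [LinearMap.lTensor_tmul, TensorProduct.rid_tmul] at this
  exact smul_right_injective M hD this

end Cancel

section Modules

variable {k : Type*} [Field k] {K : Type*} [Ring K] [HopfAlgebra k K]
  {M : Type*} [AddCommGroup M] [Module k M]

theorem twistedAct_comul₃_tmul (act : K →ₐ[k] Module.End k M) {χ : K →ₐ[k] k} {v : M}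
    (hv : ∀ h, act h v = χ h • v) (g h : K) :
    twistedAct act (comul₃ h) (g ⊗ₜ v) = twistedConj g χ h ⊗ₜ[k] v := by
  rw [twistedConj, LinearMap.comp_apply, LinearMap.comp_apply]
  induction comul₃ (k := k) h using TensorProduct.induction_on with
  | zero => simp
  | add s t hs ht => simp only [map_add, LinearMap.add_apply, hs, ht, TensorProduct.add_tmul]
  | tmul a t =>
    induction t using TensorProduct.induction_on with
    | zero => simp
    | add s t hs ht =>
      simp only [TensorProduct.tmul_add, map_add, LinearMap.add_apply, hs, ht,
        TensorProduct.add_tmul]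
    | tmul b c => simp [twistedAct_tmul, hv, TensorProduct.smul_tmul']

end Modules

/-! ### Relations among the primitive generators. -/

namespace BraidedHopfAlgebra

variable {k : Type*} [Field k] {K : Type*} [Ring K] [HopfAlgebra k K]
  {R : Type*} [Ring R] [Algebra k R] (B : BraidedHopfAlgebra k K R)

theorem comul_mul_of_primitive {a b : R} {u : K} {s : k} (ha : a ∈ B.primitives)
    (hb : b ∈ B.primitives) (hco : B.coact a = u ⊗ₜ a) (hact : B.act u b = s • b)
    (hu : IsGroupLikeElem k u) :
    B.comul (a * b) = (a * b) ⊗ₜ 1 + 1 ⊗ₜ (a * b) + a ⊗ₜ b + s • (b ⊗ₜ a) := by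
  rw [mem_primitives] at ha hb
  have hone : B.coact 1 = (1 : K) ⊗ₜ (1 : R) := B.coact_one
  have hact1 (a : R) : B.act 1 a = (1 : k) • a := by simp
  have hone' : B.act u 1 = (1 : k) • (1 : R) := by
    rw [B.act_one_of_isGroupLikeElem hu, one_smul]
  rw [B.comul_mul, ha, hb]
  simp only [TensorProduct.add_tmul, TensorProduct.tmul_add, map_add]
  rw [braidedMul_tmul_of_eq _ hone (hact1 _), braidedMul_tmul_of_eq _ hone (hact1 _),
    braidedMul_tmul_of_eq _ hco hact, braidedMul_tmul_of_eq _ hco hone']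
  simp only [one_mul, mul_one, one_smul]
  abel

/-- All intermediate quantum binomial coefficients vanish at the order of `q`. -/
theorem pow_orderOf_mem_primitives {r : R} {g : K} {q : k} (hg : IsGroupLikeElem k g)
    (hr : r ∈ B.primitives) (hco : B.coact r = g ⊗ₜ r) (hact : B.act g r = q • r)
    (hq : 1 < orderOf q) : r ^ orderOf q ∈ B.primitives := by
  rw [mem_primitives, B.comul_pow_of_primitive hg hr hco hact, Finset.sum_range_succ,
    Finset.sum_eq_single 0]
  · simp [add_comm]
  · intro a ha ha0
    rw [qBinom_orderOf_eq_zero hq (Nat.pos_of_ne_zero ha0) (Finset.mem_range.1 ha), zero_smul]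
  · intro h
    exact absurd (Finset.mem_range.2 (by omega)) h

variable {m : ℕ} {x : Module.Basis (Fin m) k B.primitives} {g : Fin m → K}
  {χ : Fin m → K →ₐ[k] k}

theorem exists_dual_basis (x : Module.Basis (Fin m) k B.primitives) :
    ∃ D : Fin m → R →ₗ[k] k, (∀ i, D i (x i) = 1) ∧ ∀ i j, j ≠ i → D i (x j) = 0 := by
  choose D hD using fun i => LinearMap.exists_extend (x.coord i)
  have h (i j : Fin m) : D i (x j) = x.coord i (x j) := congr($(hD i) (x j))
  exact ⟨D, fun i => by simp [h], fun i j hij => by simp [h, hij]⟩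

/-- A nonzero homogeneous primitive element has the degree of one of the basis elements. -/
theorem exists_eq_of_mem_primitives (hx : B.IsHomogeneousFamily (fun i => (x i : R)) g χ) {y : R}
    (hy : y ∈ B.primitives) (hy0 : y ≠ 0) {u : K} (hu : B.coact y = u ⊗ₜ y) :
    ∃ l, g l = u ∧ ∀ h s, B.act h y = s • y → χ l h = s := by
  obtain ⟨D, hD1, hD0⟩ := B.exists_dual_basis x
  set c := x.repr ⟨y, hy⟩ with hcdef
  have hsum : ∑ i, c i • (x i : R) = y := by
    have h := congr(B.primitives.subtype $(x.sum_repr ⟨y, hy⟩))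
    simp only [map_sum, map_smul] at h
    exact h
  have hc0 : c ≠ 0 := by
    intro h
    apply hy0
    rw [← hsum, h]
    simp
  obtain ⟨l, hl⟩ := Finsupp.ne_iff.1 hc0
  rw [Finsupp.zero_apply] at hl
  have hDy : D l y = c l := by
    rw [← hsum, map_sum, Finset.sum_eq_single l]
    · simp [hD1]
    · intro i _ hi; simp [hD0 l i hi]
    · simp
  refine ⟨l, ?_, fun h s hs => ?_⟩
  · have h1 := congr(TensorProduct.rid k K (LinearMap.lTensor K (D l) $hu))
    conv_lhs at h1 => rw [← hsum]
    rw [map_sum, map_sum, map_sum, Finset.sum_eq_single l] at h1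
    · simp only [map_smul, hx.coact_eq, LinearMap.lTensor_tmul, TensorProduct.rid_tmul, hD1, hDy,
        one_smul] at h1
      exact smul_right_injective K hl h1
    · intro i _ hi; simp [hx.coact_eq, hD0 l i hi]
    · simp
  · have h1 := congr(D l $hs)
    conv_lhs at h1 => rw [← hsum]
    rw [map_sum, map_sum, Finset.sum_eq_single l] at h1
    · simp only [map_smul, hx.act_eq, hD1, hDy, smul_eq_mul, mul_one] at h1
      rw [mul_comm] at h1
      exact mul_right_cancel₀ hl h1
    · intro i _ hi; simp [hx.act_eq, hD0 l i hi]
    · simp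

/-- For `h = g_i` the Yetter-Drinfeld condition on `x_j` says `g_j = g_i g_j S(g_i)`, after
cancelling the nonzero scalar `χ_j(g_i)`. -/
theorem groupLike_mul_comm (hx : B.IsHomogeneousFamily (fun i => (x i : R)) g χ) (i j : Fin m) :
    g i * g j = g j * g i := by
  obtain ⟨D, hD1, hD0⟩ := B.exists_dual_basis x
  have hg := hx.isGroupLike i
  have h := B.coact_act (g i) (x j)
  rw [hx.act_eq, hx.coact_eq, comul₃, LinearMap.comp_apply, hg.comul_eq_tmul_self,
    LinearMap.lTensor_tmul, hg.comul_eq_tmul_self, twistedAct_tmul, hx.act_eq, map_smul,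
    hx.coact_eq, TensorProduct.tmul_smul] at h
  have h2 := smul_right_injective _ (hg.isUnit.map (χ j)).ne_zero h
  have h3 := tmul_left_cancel_of_apply_ne_zero (by rw [hD1 j]; exact one_ne_zero) h2
  rw [h3, mul_assoc, mul_assoc, hg.antipode_mul_cancel, mul_one, ← h3]

theorem smul_eq_twistedConj (hx : B.IsHomogeneousFamily (fun i => (x i : R)) g χ) (i : Fin m)
    (h : K) : χ i h • g i = twistedConj (g i) (χ i) h := by
  obtain ⟨D, hD1, hD0⟩ := B.exists_dual_basis x
  have h1 := B.coact_act h (x i)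
  rw [hx.act_eq, hx.coact_eq, twistedAct_comul₃_tmul _ (hx.act_eq i), map_smul, hx.coact_eq,
    TensorProduct.smul_tmul'] at h1
  exact tmul_left_cancel_of_apply_ne_zero (by rw [hD1 i]; exact one_ne_zero) h1

theorem linearIndependent_coe_basis (x : Module.Basis (Fin m) k B.primitives) :
    LinearIndependent k fun i => (x i : R) :=
  x.linearIndependent.map' B.primitives.subtype (Submodule.ker_subtype _)

/-- Otherwise this primitive power has the degree `g_l = g_i^(N_i)` of some `x_l`, and then
`χ_l(g_l) = χ_i(g_l)^(N_i)` is a power of `q_i^(N_i) = 1`, against `N_l > 1`. -/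
theorem pow_orderOf_eq_zero (hA : B.HypothesisA x g χ) (hN : ∀ i, 1 < orderOf (χ i (g i)))
    (i : Fin m) : (x i : R) ^ orderOf (χ i (g i)) = 0 := by
  have hx := hA.homogeneous
  by_contra h0
  obtain ⟨l, hl, hχ⟩ := B.exists_eq_of_mem_primitives hx
    (B.pow_orderOf_mem_primitives (hx.isGroupLike i) (x i).2 (hx.coact_eq i) (hx.act_eq i _) (hN i))
    h0 (B.coact_pow_of_eq (hx.coact_eq i) _)
  have h1 := hχ (g l) _ (by
    rw [B.act_pow_of_isGroupLikeElem (hx.isGroupLike l), hx.act_eq, smul_pow])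
  rw [hl, map_pow, map_pow (χ i), pow_orderOf_eq_one, one_pow, ← map_pow, ← hl] at h1
  have := hN l
  rw [h1, orderOf_one] at this
  exact lt_irrefl _ this

/-- The coefficient `χ_j(g_i)` is the one for which the two `x_j ⊗ x_i` terms cancel. -/
theorem comul_commutator (hx : B.IsHomogeneousFamily (fun i => (x i : R)) g χ) (i j : Fin m) :
    B.comul (x i * x j - χ j (g i) • (x j * x i) : R) =
      (x i * x j - χ j (g i) • (x j * x i) : R) ⊗ₜ 1 +
        1 ⊗ₜ (x i * x j - χ j (g i) • (x j * x i) : R) +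
          (1 - χ j (g i) * χ i (g j)) • ((x i : R) ⊗ₜ (x j : R)) := by
  rw [map_sub, map_smul,
    B.comul_mul_of_primitive (x i).2 (x j).2 (hx.coact_eq i) (hx.act_eq j _) (hx.isGroupLike i),
    B.comul_mul_of_primitive (x j).2 (x i).2 (hx.coact_eq j) (hx.act_eq i _) (hx.isGroupLike j)]
  simp only [TensorProduct.sub_tmul, TensorProduct.tmul_sub, TensorProduct.tmul_smul,
    ← TensorProduct.smul_tmul']
  module

theorem braid_eq_one (hA : B.HypothesisA x g χ)
    (hdim : Module.rank k R = ((∏ i, orderOf (χ i (g i)) : ℕ) : Cardinal)) {i j : Fin m}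
    (hij : i ≠ j) : χ j (g i) * χ i (g j) = 1 :=
  (sub_eq_zero.1 (B.eq_zero_of_comul_eq hA.homogeneous (fun i => (x i).2)
    (B.linearIndependent_coe_basis x) hA.isOfFinOrder hdim hij
    (B.comul_commutator hA.homogeneous i j))).symm

/-- By the braiding condition the skew commutator is primitive. If it were nonzero, some `l` would
satisfy `g_l = g_i g_j`, with `χ_l = χ_i χ_j` on group-likes. The braiding conditions for `(i, l)`
and `(j, l)` then give `q_i² = q_j² = 1`, so `q_i = q_j = -1` and `q_l = q_i q_j = 1`, a
contradiction. -/
theorem mul_eq_smul_mul (hA : B.HypothesisA x g χ) (hN : ∀ i, 1 < orderOf (χ i (g i)))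
    (hbr : ∀ i j, i ≠ j → χ j (g i) * χ i (g j) = 1) {i j : Fin m} (hij : i ≠ j) :
    (x i * x j : R) = χ j (g i) • (x j * x i : R) := by
  have hx := hA.homogeneous
  have hne (l : Fin m) : χ l (g l) ≠ 1 := fun h => by simpa [h] using hN l
  rw [← sub_eq_zero]
  by_contra h0
  have hy := B.comul_commutator hx i j
  rw [hbr i j hij, sub_self, zero_smul, add_zero, ← mem_primitives] at hy
  have hco : B.coact (x i * x j - χ j (g i) • (x j * x i) : R) =
      (g i * g j) ⊗ₜ (x i * x j - χ j (g i) • (x j * x i) : R) := by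
    rw [map_sub, map_smul, B.coact_mul_of_eq (hx.coact_eq i) (hx.coact_eq j),
      B.coact_mul_of_eq (hx.coact_eq j) (hx.coact_eq i), B.groupLike_mul_comm hx j i,
      TensorProduct.tmul_sub, TensorProduct.tmul_smul]
  obtain ⟨l, hl, hχ⟩ := B.exists_eq_of_mem_primitives hx hy h0 hco
  have hχl {u : K} (hu : IsGroupLikeElem k u) : χ l u = χ i u * χ j u := by
    refine hχ u _ ?_
    simp only [map_sub, map_smul, B.act_mul_of_isGroupLikeElem hu, hx.act_eq,
      smul_mul_smul_comm, smul_sub, smul_smul]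
    congr 2
    ring
  -- The braiding condition is available only for distinct indices; `l = i` would force `g_j = 1`
  -- and hence `q_j = 1`.
  have hli : l ≠ i := by
    rintro rfl
    have h1 : g j = 1 := (hx.isGroupLike l).isUnit.mul_left_cancel (by rw [← hl, mul_one])
    exact hne j (by rw [h1, map_one])
  have hlj : l ≠ j := by
    rintro rfl
    have h1 : g i = 1 := (hx.isGroupLike l).isUnit.mul_right_cancel (by rw [← hl, one_mul])
    exact hne i (by rw [h1, map_one])
  have hi := hbr i l hli.symm
  have hj := hbr j l hlj.symm
  have hll : χ l (g l) = χ i (g i) * χ i (g j) * (χ j (g i) * χ j (g j)) := by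
    rw [hχl (hx.isGroupLike l), hl, map_mul, map_mul]
  rw [hχl (hx.isGroupLike _), hl, map_mul] at hi hj
  have hij' := hbr i j hij
  have hi2 : χ i (g i) * χ i (g i) = 1 := by linear_combination hi - χ i (g i) * χ i (g i) * hij'
  have hj2 : χ j (g j) * χ j (g j) = 1 := by linear_combination hj - χ j (g j) * χ j (g j) * hij'
  have hi3 := (mul_self_eq_one_iff.1 hi2).resolve_left (hne i)
  have hj3 := (mul_self_eq_one_iff.1 hj2).resolve_left (hne j)
  refine hne l (hll.trans ?_)
  rw [hi3, hj3]
  linear_combination hij'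

/-- The term `x_i ⊗ x_j` occurs in the coproduct with coefficient `1`. Nonvanishing allows
characters to be compared through their action on `x_i x_j`. -/
theorem basis_mul_ne_zero (hx : B.IsHomogeneousFamily (fun i => (x i : R)) g χ) {i j : Fin m}
    (hij : i ≠ j) : (x i * x j : R) ≠ 0 := by
  obtain ⟨D, hD1, hD0⟩ := B.exists_dual_basis x
  intro h
  have h1 := B.comul_mul_of_primitive (x i).2 (x j).2 (hx.coact_eq i) (hx.act_eq j _)
    (hx.isGroupLike i)
  rw [h] at h1
  have h2 := congr(LinearMap.mul' k k (TensorProduct.map (D i) (D j) $h1))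
  simp [hD1, hD0 _ _ hij, hD0 _ _ hij.symm] at h2

/-- A braided Hopf algebra of minimal dimension gives a quantum linear space datum. -/
theorem isQLSDatum (hA : B.HypothesisA x g χ)
    (hdim : Module.rank k R = ((∏ i, orderOf (χ i (g i)) : ℕ) : Cardinal)) :
    IsQLSDatum g χ := by
  have hx := hA.homogeneous
  have hN := B.one_lt_orderOf_of_rank_eq hx (fun i => (x i).2)
    (B.linearIndependent_coe_basis x) hA.isOfFinOrder hdim
  refine ⟨hx.isGroupLike, hA.isOfFinOrder, hN, B.groupLike_mul_comm hx, fun i j => ?_,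
    B.smul_eq_twistedConj hx, fun i j => B.braid_eq_one hA hdim⟩
  rcases eq_or_ne i j with rfl | hij
  · rfl
  have hcomm := B.mul_eq_smul_mul hA hN (fun i j => B.braid_eq_one hA hdim) hij
  ext h
  -- The two sides of the commutation relation are eigenvectors for `χ_i χ_j` and `χ_j χ_i`, and
  -- they are the same nonzero vector.
  have h1 := congr(B.act h $hcomm)
  rw [map_smul, B.act_mul_of_eq_smul (hx.act_eq i) (hx.act_eq j),
    B.act_mul_of_eq_smul (hx.act_eq j) (hx.act_eq i), smul_comm, ← hcomm] at h1
  exact smul_left_injective k (B.basis_mul_ne_zero hx hij) h1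

end BraidedHopfAlgebra

/-! ### Spanning by bounded monomials in skew-commuting nilpotent generators. -/

section Spanning

variable {k A : Type*} [Field k] [Ring A] [Algebra k A]

theorem pow_mul_eq_smul_of_mul_eq_smul {a b : A} {s : k} (h : a * b = s • (b * a)) (n : ℕ) :
    a * b ^ n = s ^ n • (b ^ n * a) := by
  induction n with
  | zero => simp
  | succ n ih =>
    rw [pow_succ, ← mul_assoc, ih, smul_mul_assoc, mul_assoc, h, mul_smul_comm, smul_smul,
      ← mul_assoc, pow_succ]

theorem exists_mul_orderedMonomial {m : ℕ} {y : Fin m → A} {q : Fin m → Fin m → k}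
    (hcomm : ∀ i j, i ≠ j → y i * y j = q i j • (y j * y i)) (i : Fin m) (n : Fin m → ℕ) :
    ∃ s : k, y i * orderedMonomial y n = s • orderedMonomial y (n + Pi.single i 1) := by
  induction m with
  | zero => exact i.elim0
  | succ m ih =>
    rw [orderedMonomial_succ, orderedMonomial_succ]
    cases i using Fin.cases with
    | zero =>
      refine ⟨1, ?_⟩
      have : (fun j : Fin m => (n + Pi.single 0 1 : Fin (m + 1) → ℕ) j.succ) =
          fun j => n j.succ := by ext j; simp
      rw [this, ← mul_assoc, one_smul, Pi.add_apply, Pi.single_eq_same, pow_succ']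
    | succ i =>
      obtain ⟨s, hs⟩ := ih (q := fun i j => q i.succ j.succ)
        (fun i j hij => hcomm _ _ fun h => hij (Fin.succ_injective _ h)) i (fun j => n j.succ)
      refine ⟨q i.succ 0 ^ n 0 * s, ?_⟩
      have : (fun j : Fin m => (n + Pi.single i.succ 1 : Fin (m + 1) → ℕ) j.succ) =
          (fun j => n j.succ) + Pi.single i 1 := by ext j; simp [Pi.single_apply]
      rw [this, ← mul_assoc,
        pow_mul_eq_smul_of_mul_eq_smul (hcomm i.succ 0 (Fin.succ_ne_zero i)), smul_mul_assoc,
        mul_assoc, hs, mul_smul_comm, smul_smul]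
      simp

theorem orderedMonomial_eq_zero {m : ℕ} {y : Fin m → A} {n : Fin m → ℕ} {i : Fin m}
    (h : y i ^ n i = 0) : orderedMonomial y n = 0 :=
  List.prod_eq_zero (h ▸ List.mem_ofFn.2 ⟨i, rfl⟩)

/-- In an algebra generated by skew-commuting nilpotent elements, the ordered monomials with
bounded exponents span. -/
theorem span_range_orderedMonomial_eq_top {m : ℕ} {y : Fin m → A} {q : Fin m → Fin m → k}
    {N : Fin m → ℕ} (hcomm : ∀ i j, i ≠ j → y i * y j = q i j • (y j * y i))
    (hpow : ∀ i, y i ^ N i = 0)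
    (hgen : Algebra.adjoin k (Set.range y) = ⊤) :
    Submodule.span k (Set.range fun n : (i : Fin m) → Fin (N i) =>
      orderedMonomial y fun i => (n i : ℕ)) = ⊤ := by
  set S := Submodule.span k (Set.range fun n : (i : Fin m) → Fin (N i) =>
    orderedMonomial y fun i => (n i : ℕ)) with hS
  have hmem (n : Fin m → ℕ) : orderedMonomial y n ∈ S := by
    by_cases hn : ∀ i, n i < N i
    · exact Submodule.subset_span ⟨fun i => ⟨n i, hn i⟩, rfl⟩
    · push Not at hn
      obtain ⟨i, hi⟩ := hn
      rw [orderedMonomial_eq_zero (pow_eq_zero_of_le hi (hpow i))]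
      exact S.zero_mem
  have hmul (i : Fin m) : S ≤ S.comap (LinearMap.mulLeft k (y i)) := by
    rw [hS, Submodule.span_le]
    rintro _ ⟨n, rfl⟩
    obtain ⟨s, hs⟩ := exists_mul_orderedMonomial hcomm i fun i => (n i : ℕ)
    rw [SetLike.mem_coe, Submodule.mem_comap, LinearMap.mulLeft_apply, hs]
    exact S.smul_mem _ (hmem _)
  -- Stability under the generators makes the span a left ideal; as it contains `1`, it is
  -- everything.
  have hall (a : A) : ∀ b ∈ S, a * b ∈ S := by
    have ha : a ∈ Algebra.adjoin k (Set.range y) := hgen ▸ Algebra.mem_top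
    induction ha using Algebra.adjoin_induction with
    | mem a ha => obtain ⟨i, rfl⟩ := ha; exact fun b hb => hmul i hb
    | algebraMap r => intro b hb; rw [← Algebra.smul_def]; exact S.smul_mem r hb
    | add a a' _ _ h h' => intro b hb; rw [add_mul]; exact S.add_mem (h b hb) (h' b hb)
    | mul a a' _ _ h h' => intro b hb; rw [mul_assoc]; exact h _ (h' b hb)
  refine Submodule.eq_top_iff'.2 fun a => ?_
  simpa using hall a 1 (by simpa using hmem 0)

end Spanning

/-! ### The presented algebra of a quantum linear space. -/

section QuantumLinearSpaces

variable {k : Type*} [Field k] {K : Type*} [Ring K] [HopfAlgebra k K] {θ : ℕ}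
  (g : Fin θ → K) (χ : Fin θ → K →ₐ[k] k)

theorem QLSAlgebra.gen_pow (i : Fin θ) : QLSAlgebra.gen g χ i ^ orderOf (χ i (g i)) = 0 := by
  simpa [gen] using RingQuot.mkAlgHom_rel k (QLSRel.pow (g := g) (χ := χ) i)

theorem QLSAlgebra.gen_mul_gen {i j : Fin θ} (h : i ≠ j) :
    gen g χ i * gen g χ j = χ j (g i) • (gen g χ j * gen g χ i) := by
  simpa [gen] using RingQuot.mkAlgHom_rel k (QLSRel.comm (g := g) (χ := χ) i j h)

theorem QLSAlgebra.adjoin_range_gen : Algebra.adjoin k (Set.range (gen g χ)) = ⊤ := by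
  have h : Set.range (gen g χ) =
      RingQuot.mkAlgHom k (QLSRel g χ) '' Set.range (FreeAlgebra.ι k) := by
    rw [← Set.range_comp]; rfl
  rw [h, ← AlgHom.map_adjoin, FreeAlgebra.adjoin_range_ι, Algebra.map_top,
    AlgHom.range_eq_top]
  exact RingQuot.mkAlgHom_surjective k _

/-- Elements with bounded ordered monomials forming a basis and satisfying the relations of a
quantum linear space identify the algebra with the quantum linear space. -/
theorem QLSAlgebra.exists_algEquiv {A : Type*} [Ring A] [Algebra k A] {y : Fin θ → A}
    (hpow : ∀ i, y i ^ orderOf (χ i (g i)) = 0)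
    (hcomm : ∀ i j, i ≠ j → y i * y j = χ j (g i) • (y j * y i))
    (hli : LinearIndependent k fun n : (i : Fin θ) → Fin (orderOf (χ i (g i))) =>
      orderedMonomial y fun i => (n i : ℕ))
    (hspan : Submodule.span k (Set.range fun n : (i : Fin θ) → Fin (orderOf (χ i (g i))) =>
      orderedMonomial y fun i => (n i : ℕ)) = ⊤) :
    ∃ e : QLSAlgebra g χ ≃ₐ[k] A, ∀ i, e (gen g χ i) = y i := by
  have hrel : ∀ ⦃a b⦄, QLSRel g χ a b → FreeAlgebra.lift k y a = FreeAlgebra.lift k y b := by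
    rintro _ _ (i | ⟨i, j, hij⟩)
    · simp [hpow i]
    · simp [hcomm i j hij]
  let f : QLSAlgebra g χ →ₐ[k] A := RingQuot.liftAlgHom k ⟨FreeAlgebra.lift k y, hrel⟩
  have hf (i : Fin θ) : f (gen g χ i) = y i := by simp [f, gen]
  have hfm (n : Fin θ → ℕ) : f (orderedMonomial (gen g χ) n) = orderedMonomial y n := by
    rw [map_orderedMonomial]; simp only [hf]
  have hspanA := span_range_orderedMonomial_eq_top (fun i j h => gen_mul_gen g χ h)
    (gen_pow g χ) (adjoin_range_gen g χ)
  have hsurj : Function.Surjective f := by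
    rw [← AlgHom.coe_toLinearMap, ← LinearMap.range_eq_top, eq_top_iff, ← hspan,
      Submodule.span_le]
    rintro _ ⟨n, rfl⟩
    exact ⟨_, hfm _⟩
  -- A kernel element is a combination of bounded monomials, whose images are independent;
  -- independence inside the presented algebra need not be known beforehand.
  have hinj : Function.Injective f := by
    rw [injective_iff_map_eq_zero]
    intro a ha
    obtain ⟨c, rfl⟩ := (Submodule.mem_span_range_iff_exists_fun k).1
      (hspanA ▸ Submodule.mem_top : a ∈ _)
    rw [map_sum] at ha
    simp only [map_smul, hfm] at ha
    have := Fintype.linearIndependent_iff.1 hli c ha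
    simp [this]
  exact ⟨AlgEquiv.ofBijective f ⟨hinj, hsurj⟩, hf⟩

end QuantumLinearSpaces

/-! ### Transport of Yetter-Drinfeld, coalgebra and braided Hopf structures along isomorphisms. -/

section Transport

variable {k : Type*} [Field k] {K : Type*} [Ring K] [HopfAlgebra k K]

namespace YDModule

variable {M M' : Type*} [AddCommGroup M] [Module k M] [AddCommGroup M'] [Module k M']

theorem lTensor_twistedAct {act : K →ₐ[k] Module.End k M} {act' : K →ₐ[k] Module.End k M'}
    {f : M →ₗ[k] M'} (hf : ∀ h v, f (act h v) = act' h (f v)) (t : K ⊗[k] (K ⊗[k] K))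
    (z : K ⊗[k] M) :
    LinearMap.lTensor K f (twistedAct act t z) = twistedAct act' t (LinearMap.lTensor K f z) := by
  induction z using TensorProduct.induction_on with
  | zero => simp
  | add z z' h h' => simp only [map_add, h, h']
  | tmul u v =>
    induction t using TensorProduct.induction_on with
    | zero => simp
    | add s t h h' => simp only [map_add, LinearMap.add_apply, h, h']
    | tmul a t =>
      induction t using TensorProduct.induction_on with
      | zero => simp
      | add s t h h' => simp only [TensorProduct.tmul_add, map_add, LinearMap.add_apply, h, h']
      | tmul b c => simp [twistedAct_tmul, hf]

/-- A morphism of Yetter-Drinfeld modules. -/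
structure IsHom (V : YDModule k K M) (V' : YDModule k K M') (f : M →ₗ[k] M') : Prop where
  map_act : ∀ h v, f (V.act h v) = V'.act h (f v)
  map_coact : ∀ v, V'.coact (f v) = LinearMap.lTensor K f (V.coact v)

variable {V : YDModule k K M} {V' : YDModule k K M'} {f : M →ₗ[k] M'}

theorem IsHom.map_diagAct (hf : IsHom V V' f) (h : K) (z : M ⊗[k] M) :
    TensorProduct.map f f (V.diagAct h z) = V'.diagAct h (TensorProduct.map f f z) := by
  simp only [diagAct, LinearMap.comp_apply]
  induction z using TensorProduct.induction_on with
  | zero => simp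
  | add z z' h h' => simp only [map_add, h, h']
  | tmul u v =>
    induction Coalgebra.comul (R := k) h using TensorProduct.induction_on with
    | zero => simp
    | add s t h h' => simp only [map_add, LinearMap.add_apply, h, h']
    | tmul a b => simp [hf.map_act]

theorem IsHom.map_codiagCoact (hf : IsHom V V' f) (z : M ⊗[k] M) :
    V'.codiagCoact (TensorProduct.map f f z) =
      LinearMap.lTensor K (TensorProduct.map f f) (V.codiagCoact z) := by
  induction z using TensorProduct.induction_on with
  | zero => simp
  | add z z' h h' => simp only [map_add, h, h']
  | tmul u v =>
    simp only [codiagCoact, LinearMap.comp_apply, TensorProduct.map_tmul, hf.map_coact]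
    induction V.coact u using TensorProduct.induction_on with
    | zero => simp
    | add z z' h h' => simp only [map_add, TensorProduct.add_tmul, h, h']
    | tmul a u =>
      induction V.coact v using TensorProduct.induction_on with
      | zero => simp
      | add z z' h h' => simp only [map_add, TensorProduct.tmul_add, h, h']
      | tmul b v => simp

theorem IsHom.map_braiding (hf : IsHom V V' f) (z : M ⊗[k] M) :
    V'.braiding (TensorProduct.map f f z) = TensorProduct.map f f (V.braiding z) := by
  induction z using TensorProduct.induction_on with
  | zero => simp
  | add z z' h h' => simp only [map_add, h, h']
  | tmul u v =>
    simp only [braiding, LinearMap.comp_apply, TensorProduct.map_tmul, LinearMap.rTensor_tmul,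
      hf.map_coact]
    induction V.coact u using TensorProduct.induction_on with
    | zero => simp
    | add z z' h h' => simp only [map_add, TensorProduct.add_tmul, h, h']
    | tmul a u => simp [hf.map_act]

theorem lTensor_lTensor_assoc_rTensor (f : M →ₗ[k] M') (D : K →ₗ[k] K ⊗[k] K) (z : K ⊗[k] M) :
    LinearMap.lTensor K (LinearMap.lTensor K f) (TensorProduct.assoc k K K M (D.rTensor M z)) =
      TensorProduct.assoc k K K M' (D.rTensor M' (LinearMap.lTensor K f z)) := by
  induction z using TensorProduct.induction_on with
  | zero => simp
  | add z z' h h' => simp only [map_add, h, h']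
  | tmul a v =>
    simp only [LinearMap.rTensor_tmul, LinearMap.lTensor_tmul]
    induction D a using TensorProduct.induction_on with
    | zero => simp
    | add z z' h h' => simp only [map_add, TensorProduct.add_tmul, h, h']
    | tmul a b => simp

theorem lTensor_symm_coact (W : M' →ₗ[k] K ⊗[k] M') (e : M ≃ₗ[k] M') (v : M) :
    LinearMap.lTensor K e.toLinearMap
      (((LinearEquiv.lTensor K e.symm).toLinearMap ∘ₗ W ∘ₗ e.toLinearMap) v) = W (e v) :=
  (LinearEquiv.lTensor K e).apply_symm_apply _

/-- Transport of a Yetter-Drinfeld module structure along a linear equivalence. -/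
def congr (V : YDModule k K M') (e : M ≃ₗ[k] M') : YDModule k K M where
  act := ((LinearEquiv.conjAlgEquiv k e.symm : _ ≃ₐ[k] _) : _ →ₐ[k] _).comp V.act
  coact := (LinearEquiv.lTensor K e.symm).toLinearMap ∘ₗ V.coact ∘ₗ e.toLinearMap
  coact_coassoc := by
    ext v
    refine (LinearEquiv.lTensor K (LinearEquiv.lTensor K e)).injective ?_
    have hco := lTensor_symm_coact V.coact e
    set W := (LinearEquiv.lTensor K e.symm).toLinearMap ∘ₗ V.coact ∘ₗ e.toLinearMap
    have hW : LinearMap.lTensor K e.toLinearMap ∘ₗ W = V.coact ∘ₗ e.toLinearMap :=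
      LinearMap.ext hco
    clear_value W
    refine (lTensor_lTensor_assoc_rTensor e.toLinearMap _ (W v)).trans ?_
    change _ = LinearMap.lTensor K (LinearMap.lTensor K e.toLinearMap) (LinearMap.lTensor K W (W v))
    rw [← LinearMap.comp_apply (LinearMap.lTensor K (LinearMap.lTensor K e.toLinearMap)),
      ← LinearMap.lTensor_comp, hW, LinearMap.lTensor_comp, LinearMap.comp_apply, hco]
    exact congr($(V.coact_coassoc) (e v))
  coact_counit := by
    ext v
    refine (LinearEquiv.lTensor k e).injective ?_
    have hco := lTensor_symm_coact V.coact e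
    set W := (LinearEquiv.lTensor K e.symm).toLinearMap ∘ₗ V.coact ∘ₗ e.toLinearMap
    change LinearMap.lTensor k e.toLinearMap (LinearMap.rTensor M Coalgebra.counit (W v)) = 1 ⊗ₜ e v
    rw [← LinearMap.comp_apply, LinearMap.lTensor_comp_rTensor, ← LinearMap.rTensor_comp_lTensor,
      LinearMap.comp_apply, hco]
    exact congr($(V.coact_counit) (e v))
  coact_act h v := by
    refine (LinearEquiv.lTensor K e).injective ?_
    refine (lTensor_symm_coact V.coact e _).trans ?_
    refine Eq.trans ?_ (lTensor_twistedAct (f := e.toLinearMap) (act' := V.act) ?_ _ _).symm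
    · rw [lTensor_symm_coact, ← V.coact_act]
      simp [LinearEquiv.conjAlgEquiv_apply]
    · intro h v
      simp [LinearEquiv.conjAlgEquiv_apply]

theorem isHom_congr (V : YDModule k K M') (e : M ≃ₗ[k] M') :
    IsHom (V.congr e) V e.toLinearMap where
  map_act h v := by simp [congr, LinearEquiv.conjAlgEquiv_apply]
  map_coact v := (lTensor_symm_coact V.coact e v).symm

end YDModule

section Algebra

variable {R R' : Type*} [Ring R] [Algebra k R] [Ring R'] [Algebra k R']
  {V : YDModule k K R} {V' : YDModule k K R'}

theorem map_braidedMul {f : R ≃ₐ[k] R'} (hf : V.IsHom V' f.toLinearMap)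
    (z : (R ⊗[k] R) ⊗[k] (R ⊗[k] R)) :
    TensorProduct.map f.toLinearMap f.toLinearMap (braidedMul V z) =
      braidedMul V' (TensorProduct.map (TensorProduct.map f.toLinearMap f.toLinearMap)
        (TensorProduct.map f.toLinearMap f.toLinearMap) z) := by
  induction z using TensorProduct.induction_on with
  | zero => simp
  | add z z' h h' => simp only [map_add, h, h']
  | tmul s t =>
    induction s using TensorProduct.induction_on with
    | zero => simp
    | add z z' h h' => simp only [map_add, TensorProduct.add_tmul, h, h']
    | tmul a b =>
      induction t using TensorProduct.induction_on with
      | zero => simp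
      | add z z' h h' => simp only [map_add, TensorProduct.tmul_add, h, h']
      | tmul c d =>
        have hbr : V'.braiding (f b ⊗ₜ f c) =
          TensorProduct.map f.toLinearMap f.toLinearMap (V.braiding (b ⊗ₜ c)) :=
          hf.map_braiding (b ⊗ₜ c)
        simp only [braidedMul, LinearMap.comp_apply, TensorProduct.map_tmul,
          LinearEquiv.coe_coe, TensorProduct.assoc_tmul, LinearMap.lTensor_tmul,
          TensorProduct.assoc_symm_tmul, LinearMap.rTensor_tmul,
          AlgEquiv.toLinearMap_apply, hbr]
        induction V.braiding (b ⊗ₜ c) using TensorProduct.induction_on with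
        | zero => simp
        | add z z' h h' => simp only [map_add, TensorProduct.add_tmul, TensorProduct.tmul_add, h, h']
        | tmul u v => simp

/-- Transport of a coalgebra structure along a linear equivalence. -/
abbrev coalgebraCongr {M M' : Type*} [AddCommGroup M] [Module k M] [AddCommGroup M'] [Module k M']
    (C : Coalgebra k M') (e : M ≃ₗ[k] M') : Coalgebra k M where
  comul := (TensorProduct.congr e e).symm.toLinearMap ∘ₗ C.comul ∘ₗ e.toLinearMap
  counit := C.counit ∘ₗ e.toLinearMap
  coassoc := by
    set Δ := (TensorProduct.congr e e).symm.toLinearMap ∘ₗ C.comul ∘ₗ e.toLinearMap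
    have hΔ (v : M) : TensorProduct.congr e e (Δ v) = C.comul (e v) :=
      (TensorProduct.congr e e).apply_symm_apply _
    ext v
    refine (TensorProduct.congr e (TensorProduct.congr e e)).injective ?_
    simp only [LinearMap.comp_apply, LinearEquiv.coe_coe]
    have h1 (z : M ⊗[k] M) : TensorProduct.congr e (TensorProduct.congr e e)
        (TensorProduct.assoc k M M M (Δ.rTensor M z)) =
        TensorProduct.assoc k M' M' M' (C.comul.rTensor M' (TensorProduct.congr e e z)) := by
      induction z using TensorProduct.induction_on with
      | zero => simp
      | add z z' h h' => simp only [map_add, h, h']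
      | tmul a b =>
        simp only [LinearMap.rTensor_tmul, TensorProduct.congr_tmul, ← hΔ]
        induction Δ a using TensorProduct.induction_on with
        | zero => simp
        | add z z' h h' => simp only [map_add, TensorProduct.add_tmul, h, h']
        | tmul a b => simp
    have h2 (z : M ⊗[k] M) : TensorProduct.congr e (TensorProduct.congr e e) (Δ.lTensor M z) =
        C.comul.lTensor M' (TensorProduct.congr e e z) := by
      induction z using TensorProduct.induction_on with
      | zero => simp
      | add z z' h h' => simp only [map_add, h, h']
      | tmul a b => simp [hΔ]
    rw [h1, h2, hΔ]
    exact congr($(C.coassoc) (e v))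
  rTensor_counit_comp_comul := by
    ext v
    refine (LinearEquiv.lTensor k e).injective ?_
    have h (z : M' ⊗[k] M') : LinearMap.lTensor k e.toLinearMap
        (LinearMap.rTensor M (C.counit ∘ₗ e.toLinearMap) ((TensorProduct.congr e e).symm z)) =
        LinearMap.rTensor M' C.counit z := by
      induction z using TensorProduct.induction_on with
      | zero => simp
      | add z z' h h' => simp only [map_add, h, h']
      | tmul a b => simp
    exact (h _).trans congr($(C.rTensor_counit_comp_comul) (e v))
  lTensor_counit_comp_comul := by
    ext v
    refine (LinearEquiv.rTensor k e).injective ?_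
    have h (z : M' ⊗[k] M') : LinearMap.rTensor k e.toLinearMap
        (LinearMap.lTensor M (C.counit ∘ₗ e.toLinearMap) ((TensorProduct.congr e e).symm z)) =
        LinearMap.lTensor M' C.counit z := by
      induction z using TensorProduct.induction_on with
      | zero => simp
      | add z z' h h' => simp only [map_add, h, h']
      | tmul a b => simp
    exact (h _).trans congr($(C.lTensor_counit_comp_comul) (e v))

namespace BraidedHopfAlgebra

theorem map_mul'_apply (e : R ≃ₐ[k] R') (z : R ⊗[k] R) :
    e (LinearMap.mul' k R z) =
      LinearMap.mul' k R' (TensorProduct.map e.toLinearMap e.toLinearMap z) := by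
  induction z using TensorProduct.induction_on with
  | zero => simp
  | add z z' h h' => simp only [map_add, h, h']
  | tmul a b => simp

/-- Transport of a braided Hopf algebra structure along an algebra isomorphism. -/
def congr (B : BraidedHopfAlgebra k K R') (e : R ≃ₐ[k] R') : BraidedHopfAlgebra k K R :=
  let E := e.toLinearEquiv
  let V := B.toYDModule.congr E
  let C := coalgebraCongr B.toCoalgebra E
  let S := E.symm.toLinearMap ∘ₗ B.antipode ∘ₗ E.toLinearMap
  have hV : V.IsHom B.toYDModule e.toLinearMap := B.toYDModule.isHom_congr E
  have hact (h : K) (v : R) : e (V.act h v) = B.act h (e v) := hV.map_act h v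
  have hcoact (v : R) : LinearMap.lTensor K e.toLinearMap (V.coact v) = B.coact (e v) :=
    (hV.map_coact v).symm
  have hΔ (v : R) : TensorProduct.map e.toLinearMap e.toLinearMap (C.comul v) = B.comul (e v) :=
    (TensorProduct.congr E E).apply_symm_apply _
  have hΔ' : TensorProduct.map e.toLinearMap e.toLinearMap ∘ₗ C.comul =
      B.comul ∘ₗ e.toLinearMap := LinearMap.ext hΔ
  have hS : e.toLinearMap ∘ₗ S = B.antipode ∘ₗ e.toLinearMap :=
    LinearMap.ext fun v => e.apply_symm_apply _
  have hmul : e.toLinearMap ∘ₗ LinearMap.mul' k R =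
      LinearMap.mul' k R' ∘ₗ TensorProduct.map e.toLinearMap e.toLinearMap :=
    LinearMap.ext (map_mul'_apply e)
  -- Each axiom is checked after applying the injective map induced by `e`, where it becomes the
  -- corresponding axiom of `B`.
  have hinj : Function.Injective (TensorProduct.map e.toLinearMap e.toLinearMap) :=
    (TensorProduct.congr E E).injective
  have hinjK : Function.Injective (LinearMap.lTensor K e.toLinearMap) :=
    (LinearEquiv.lTensor K E).injective
  have hinjKK : Function.Injective
      (LinearMap.lTensor K (TensorProduct.map e.toLinearMap e.toLinearMap)) :=
    (LinearEquiv.lTensor K (TensorProduct.congr E E)).injective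
  { toYDModule := V
    toCoalgebra := C
    act_mul := fun h => LinearMap.ext fun z => e.injective <| by
      rw [LinearMap.comp_apply, LinearMap.comp_apply, hact, map_mul'_apply, map_mul'_apply,
        hV.map_diagAct]
      exact congr($(B.act_mul h) _)
    act_one := fun h => e.injective <| by
      rw [hact, map_one e, map_smul, map_one e, B.act_one]
    coact_mul := LinearMap.ext fun z => hinjK <| by
      rw [LinearMap.comp_apply, LinearMap.comp_apply, hcoact, map_mul'_apply,
        ← LinearMap.comp_apply (LinearMap.lTensor K e.toLinearMap), ← LinearMap.lTensor_comp, hmul,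
        LinearMap.lTensor_comp, LinearMap.comp_apply, ← hV.map_codiagCoact]
      exact congr($(B.coact_mul) _)
    coact_one := hinjK <| by
      rw [hcoact, map_one, B.coact_one, LinearMap.lTensor_tmul, AlgEquiv.toLinearMap_apply, map_one]
    comul_act := fun h => LinearMap.ext fun v => hinj <| by
      rw [LinearMap.comp_apply, LinearMap.comp_apply, hΔ, hact, hV.map_diagAct, hΔ]
      exact congr($(B.comul_act h) _)
    counit_act := fun h r =>
      (congrArg B.counit (hact h r)).trans (B.counit_act h (e r))
    coact_comul := LinearMap.ext fun v => hinjKK <| by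
      rw [LinearMap.comp_apply, LinearMap.comp_apply, ← hV.map_codiagCoact, hΔ,
        ← LinearMap.comp_apply (LinearMap.lTensor K (TensorProduct.map _ _)),
        ← LinearMap.lTensor_comp, hΔ', LinearMap.lTensor_comp, LinearMap.comp_apply, hcoact]
      exact congr($(B.coact_comul) _)
    coact_counit' := fun r => by
      have h : C.counit = B.counit ∘ₗ e.toLinearMap := rfl
      rw [h, LinearMap.lTensor_comp, LinearMap.comp_apply, hcoact, B.coact_counit']
      rfl
    comul_mul := fun a b => hinj <| by
      rw [hΔ, map_mul, map_braidedMul hV, TensorProduct.map_tmul, hΔ, hΔ, B.comul_mul]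
    comul_one := hinj <| by
      rw [hΔ, map_one, B.comul_one, TensorProduct.map_tmul, AlgEquiv.toLinearMap_apply, map_one]
    counit_mul := fun a b => (congrArg B.counit (map_mul e a b)).trans (B.counit_mul _ _)
    counit_one := (congrArg B.counit (map_one e)).trans B.counit_one
    antipode := S
    mul_antipode_rTensor_comul := LinearMap.ext fun v => e.injective <| by
      rw [LinearMap.comp_apply, LinearMap.comp_apply, map_mul'_apply,
        ← LinearMap.comp_apply (TensorProduct.map _ _), LinearMap.map_comp_rTensor, hS,
        ← LinearMap.rTensor_comp_map, LinearMap.comp_apply, hΔ]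
      exact congr($(B.mul_antipode_rTensor_comul) (e v)).trans (e.commutes _).symm
    mul_antipode_lTensor_comul := LinearMap.ext fun v => e.injective <| by
      rw [LinearMap.comp_apply, LinearMap.comp_apply, map_mul'_apply,
        ← LinearMap.comp_apply (TensorProduct.map _ _), LinearMap.map_comp_lTensor, hS,
        ← LinearMap.lTensor_comp_map, LinearMap.comp_apply, hΔ]
      exact congr($(B.mul_antipode_lTensor_comul) (e v)).trans (e.commutes _).symm }

theorem isIso_congr (B : BraidedHopfAlgebra k K R') (e : R ≃ₐ[k] R') : (B.congr e).IsIso B e where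
  map_act := (B.toYDModule.isHom_congr e.toLinearEquiv).map_act
  map_coact := (B.toYDModule.isHom_congr e.toLinearEquiv).map_coact
  map_comul _ := ((TensorProduct.congr e.toLinearEquiv e.toLinearEquiv).apply_symm_apply _).symm
  map_counit _ := rfl

theorem IsIso.isHomogeneousFamily {B : BraidedHopfAlgebra k K R} {B' : BraidedHopfAlgebra k K R'}
    {e : R ≃ₐ[k] R'} (he : B.IsIso B' e) {ι : Type*} {x : ι → R} {g : ι → K} {χ : ι → K →ₐ[k] k}
    (hx : B'.IsHomogeneousFamily (fun i => e (x i)) g χ) : B.IsHomogeneousFamily x g χ where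
  isGroupLike := hx.isGroupLike
  coact_eq i := (LinearEquiv.lTensor K e.toLinearEquiv).injective
    ((he.map_coact _).symm.trans (hx.coact_eq i))
  act_eq i h := e.injective <| by rw [he.map_act, hx.act_eq, map_smul]

theorem IsIso.mem_primitives {B : BraidedHopfAlgebra k K R} {B' : BraidedHopfAlgebra k K R'}
    {e : R ≃ₐ[k] R'} (he : B.IsIso B' e) {r : R} (hr : e r ∈ B'.primitives) :
    r ∈ B.primitives := by
  rw [BraidedHopfAlgebra.mem_primitives] at hr ⊢
  refine (TensorProduct.congr e.toLinearEquiv e.toLinearEquiv).injective ?_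
  refine (he.map_comul r).symm.trans (hr.trans ?_)
  simp

end BraidedHopfAlgebra

end Algebra

end Transport

end YetterDrinfeld

end

/-! ### Assembly of the main theorem. -/

theorem proposition3p5 {k K R : Type*} [Field k] [IsAlgClosed k] [CharZero k]
    [Ring K] [HopfAlgebra k K] [Ring R] [Algebra k R]
    (B : YetterDrinfeld.BraidedHopfAlgebra k K R) {θ : ℕ}
    (x : Module.Basis (Fin θ) k B.primitives) (g : Fin θ → K) (χ : Fin θ → K →ₐ[k] k)
    (hA : B.HypothesisA x g χ)
    (hdim : Module.rank k R = ((∏ i, orderOf (χ i (g i)) : ℕ) : Cardinal)) :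
    (∀ i j, i ≠ j → χ j (g i) * χ i (g j) = 1) ∧
      YetterDrinfeld.IsQuantumLinearSpace B g χ := by
  have hQ := B.isQLSDatum hA hdim
  have hx := hA.homogeneous
  have hP (i : Fin θ) : (x i : R) ∈ B.primitives := (x i).2
  have hli := B.linearIndependent_coe_basis x
  obtain ⟨e, he⟩ := YetterDrinfeld.QLSAlgebra.exists_algEquiv g χ
    (B.pow_orderOf_eq_zero hA hQ.one_lt_orderOf)
    (fun i j => B.mul_eq_smul_mul hA hQ.one_lt_orderOf hQ.braid)
    (B.linearIndependent_orderedMonomial hx hP hli fun i => le_max_right 2 _)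
    (B.span_orderedMonomial_eq_top hx hP hli hA.isOfFinOrder hdim)
  have hiso := B.isIso_congr e
  -- The structure on the presented algebra is pulled back along `e`, which makes `e` an isomorphism
  -- of braided Hopf algebras; since `e` sends generators to the `x_i`, they are primitive and
  -- homogeneous as required.
  refine ⟨hQ.braid, hQ, B.congr e, ⟨hiso.isHomogeneousFamily ?_, fun i => hiso.mem_primitives ?_⟩,
    e, hiso⟩
  · simpa only [he] using hx
  · rw [he]
    exact hP i
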